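/- Fix an integer $d\ge 1$ and reals $\tau\in(2,3)$, $w_0>0$, $\gamma>1$, and let $\mu=\frac{\tau-1}{\tau-2}w_0$. For $n\in\mathbb N$ let $\mathrm{GIRG}$ be the random graph on $V=\{1,\dots,n\}$ in which the weights $\mathrm w_1,\dots,\mathrm w_n$ are i.i.d. Pareto, with density $(\tau-1)w_0^{\tau-1}w^{-\tau}$ on $[w_0,\infty)$ (so that their mean is $\mu$), the positions $\mathrm x_1,\dots,\mathrm x_n$ are i.i.d. uniform on the torus $\mathbb T^d=\mathbb R^d/\mathbb Z^d$ and independent of the weights, and, conditionally on weights and positions, each pair $u\neq v$ is joined by an edge independently of the other pairs with probability $$p_{uv}=\min\Big\{\Big(\frac{\mathrm w_u\mathrm w_v}{n\mu\|\mathrm x_u-\mathrm x_v\|^{d}}\Big)^{\gamma},1\Big\},$$ where $\|\cdot\|$ is the $\infty$-norm on the torus. For a fixed integer $k\ge 1$ let $N(\mathcal K_k)$ be the number of sets of $k$ pairwise adjacent vertices. Define $$J^{\mathrm{NG}}=\int_{(0,\infty)^k}\int_{(\mathbb T^d)^k}(y_1\cdots y_k)^{-\tau}\prod_{i<j}\min\Big\{1,\Big(\frac{y_iy_j}{\|x_i-x_j\|^d}\Big)^{\gamma}\Big\}\,dx_1\cdots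 dx_k\,dy_1\cdots dy_k,$$ $$J^{\mathrm{G}}=\int_{(w_0,\infty)^k}\int_{(\mathbb R^d)^{k-1}}(w_1\cdots w_k)^{-\tau}\prod_{i<j}\min\Big\{1,\Big(\frac{w_iw_j}{\|z_i-z_j\|^d}\Big)^{\gamma}\Big\}\,dz_2\cdots dz_k\,dw_1\cdots dw_k,\qquad z_1:=0,$$ where in $J^{\mathrm G}$ $\|\cdot\|$ is the maximum norm on $\mathbb R^d$. Then, as $n\to\infty$: (i) If $k>\frac{2}{3-\tau}$, then $J^{\mathrm{NG}}<\infty$ and $$\frac{N(\mathcal K_k)}{n^{(3-\tau)k/2}}\ \longrightarrow\ \big((\tau-1)w_0^{\tau-1}\big)^k\,\frac{J^{\mathrm{NG}}}{\mu^{(\tau-1)k/2}\,k!}\quad\text{in probability.}$$ (ii) If $k<\frac{2}{3-\tau}$, then $J^{\mathrm{G}}<\infty$ and $$\frac{N(\mathcal K_k)}{n}\ \longrightarrow\ \big((\tau-1)w_0^{\tau-1}\big)^k\,\frac{J^{\mathrm{G}}}{\mu^{k-1}\,k!}\quad\text{in probability.}$$ -/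

import Mathlib

open MeasureTheory ProbabilityTheory Filter Topology Set
open scoped ENNReal

noncomputable section

namespace GIRG

/-- The `d`-dimensional torus `ℝ^d / ℤ^d`.  Its norm is the maximum over the coordinates of the
circle norm `min {|a|, 1 - |a|}`, and its `volume` is the uniform probability measure. -/
abbrev Torus (d : ℕ) : Type := Fin d → UnitAddCircle

/-- The law of one weight: Pareto, `ℙ(w > t) = (w₀ / t) ^ (τ - 1)` for `t ≥ w₀`, with density
`(τ - 1) w₀ ^ (τ - 1) w ^ (-τ)` on `[w₀, ∞)`. -/
def weightLaw (τ w₀ : ℝ) : Measure ℝ := paretoMeasure w₀ (τ - 1)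

/-- The mean weight `μ = 𝔼[w]`. -/
def meanWeight (τ w₀ : ℝ) : ℝ := ∫ w, w ∂(weightLaw τ w₀)

/-- The mean weight in closed form. -/
theorem meanWeight_eq {τ w₀ : ℝ} (hτ : 2 < τ) (hw₀ : 0 < w₀) :
    meanWeight τ w₀ = (τ - 1) / (τ - 2) * w₀ := by
  have h1 : ∀ x : ℝ, 0 ≤ paretoPDFReal w₀ (τ - 1) x := fun x =>
    paretoPDFReal_nonneg hw₀.le (by linarith) x
  unfold meanWeight weightLaw paretoMeasure
  rw [integral_withDensity_eq_integral_toReal_smul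
    (f := paretoPDF w₀ (τ - 1)) ((measurable_paretoPDFReal w₀ (τ - 1)).ennreal_ofReal)
    (Eventually.of_forall fun x => ENNReal.ofReal_lt_top)]
  have h2 : (fun x : ℝ => (paretoPDF w₀ (τ - 1) x).toReal • x) =
      (Ici w₀).indicator (fun x : ℝ => (τ - 1) * w₀ ^ (τ - 1) * x ^ (1 - τ)) := by
    funext x
    rw [paretoPDF, ENNReal.toReal_ofReal (h1 x), paretoPDFReal, indicator_apply]
    by_cases hx : w₀ ≤ x
    · have hx0 : 0 < x := hw₀.trans_le hx
      rw [if_pos hx, if_pos (show x ∈ Ici w₀ from hx), smul_eq_mul, mul_assoc]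
      congr 1
      rw [show 1 - τ = -(τ - 1 + 1) + 1 by ring, Real.rpow_add_one hx0.ne']
    · rw [if_neg hx, if_neg (show x ∉ Ici w₀ from hx), zero_smul]
  rw [h2, integral_indicator measurableSet_Ici, integral_Ici_eq_integral_Ioi,
    integral_const_mul, integral_Ioi_rpow_of_lt (by linarith) hw₀]
  have h3 : w₀ ^ (τ - 1) * w₀ ^ (1 - τ + 1) = w₀ := by
    rw [← Real.rpow_add hw₀]
    simp
  have h4 : τ - 2 ≠ 0 := by linarith
  have h5 : 1 - τ + 1 = -(τ - 2) := by ring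
  rw [h5] at h3 ⊢
  rw [neg_div_neg_eq, mul_assoc, mul_div_assoc', h3]
  ring

/-- The connection kernel `min {(a / r ^ d) ^ γ, 1}`.  (At `r = 0`, `d ≥ 1` the value is a
convention; in all uses this is an event of probability zero.) -/
def kernel (d : ℕ) (γ a r : ℝ) : ℝ := min ((a / r ^ d) ^ γ) 1

/-- The probability of an edge between two vertices with weights `wu`, `wv` and positions
`xu`, `xv`, in a graph on `n` vertices:
`min {(wu wv / (n μ ‖xu - xv‖ ^ d)) ^ γ, 1}`. -/
def edgeProb (d : ℕ) (τ w₀ γ : ℝ) (n : ℕ) (wu wv : ℝ) (xu xv : Torus d) : ℝ :=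
  kernel d γ (wu * wv / (n * meanWeight τ w₀)) ‖xu - xv‖

/-- `IsGIRG d τ w₀ γ n P W X G` : under `P`, the random graph `G` on `n` vertices, with weights
`W` and positions `X`, is the geometric inhomogeneous random graph. -/
structure IsGIRG (d : ℕ) (τ w₀ γ : ℝ) (n : ℕ) {Ω : Type*} [MeasurableSpace Ω] (P : Measure Ω)
    (W : Ω → Fin n → ℝ) (X : Ω → Fin n → Torus d) (G : Ω → SimpleGraph (Fin n)) : Prop where
  /-- All weights and positions are independent, the weights have the Pareto law and the positions
  are uniform on the torus. -/
  hasLaw : HasLaw (fun ω => (W ω, X ω))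
    ((Measure.pi fun _ : Fin n => weightLaw τ w₀).prod
      (Measure.pi fun _ : Fin n => (volume : Measure (Torus d)))) P
  /-- Every edge is an event. -/
  measurableSet_adj : ∀ u v : Fin n, MeasurableSet {ω | (G ω).Adj u v}
  /-- Conditionally on the weights and the positions, the edges are present independently, the
  edge between `u` and `v` with probability `edgeProb`: for any set `E` of pairs of vertices, the
  conditional probability that all of them are edges is the product of the edge probabilities. -/
  edges : ∀ E : Finset (Fin n × Fin n), (∀ e ∈ E, e.1 < e.2) →
    ∀ A : Set ((Fin n → ℝ) × (Fin n → Torus d)), MeasurableSet A →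
      P {ω | (W ω, X ω) ∈ A ∧ ∀ e ∈ E, (G ω).Adj e.1 e.2} =
        ∫⁻ ω in {ω | (W ω, X ω) ∈ A}, ∏ e ∈ E, ENNReal.ofReal
          (edgeProb d τ w₀ γ n (W ω e.1) (W ω e.2) (X ω e.1) (X ω e.2)) ∂P

/-- The number of `k`-cliques of a graph: the number of sets of `k` pairwise adjacent vertices. -/
def cliqueCount {n : ℕ} (k : ℕ) (G : SimpleGraph (Fin n)) : ℕ := (G.cliqueSet k).ncard

/-- The integral `J^NG`, over weights in `(0, ∞)` and positions on the torus, of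
`(y₁ ⋯ y_k) ^ (-τ) ∏_{i < j} min {1, (y_i y_j / ‖x_i - x_j‖ ^ d) ^ γ}`. -/
def JNG (d k : ℕ) (τ γ : ℝ) : ℝ≥0∞ :=
  ∫⁻ y in univ.pi (fun _ : Fin k => Ioi (0 : ℝ)), ∫⁻ x : Fin k → Torus d,
    ENNReal.ofReal ((∏ i, y i) ^ (-τ) *
      ∏ i, ∏ j ∈ Finset.Ioi i, kernel d γ (y i * y j) ‖x i - x j‖)

/-- The points `z₁ = 0, z₂, …, z_k` (indexed from zero) of `ℝ^d`. -/
def rooted {d k : ℕ} (z : Fin (k - 1) → Fin d → ℝ) (i : Fin k) : Fin d → ℝ :=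
  if h : (i : ℕ) = 0 then 0 else z ⟨(i : ℕ) - 1, by omega⟩

/-- The integral `J^G`, over weights in `(w₀, ∞)` and points `z₂, …, z_k` of `ℝ^d` with `z₁ = 0`,
of `(w₁ ⋯ w_k) ^ (-τ) ∏_{i < j} min {1, (w_i w_j / ‖z_i - z_j‖ ^ d) ^ γ}`, where `‖·‖` is the
maximum norm. -/
def JG (d k : ℕ) (τ w₀ γ : ℝ) : ℝ≥0∞ :=
  ∫⁻ w in univ.pi (fun _ : Fin k => Ioi w₀), ∫⁻ z : Fin (k - 1) → Fin d → ℝ,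
    ENNReal.ofReal ((∏ i, w i) ^ (-τ) *
      ∏ i, ∏ j ∈ Finset.Ioi i, kernel d γ (w i * w j) ‖rooted z i - rooted z j‖)

/-- Convergence in probability to a constant `c` of random variables `Z n`, each defined on its
own probability space. -/
def ConvergesInProbability {Ω : ℕ → Type*} [∀ n, MeasurableSpace (Ω n)]
    (P : ∀ n, Measure (Ω n)) (Z : ∀ n, Ω n → ℝ) (c : ℝ) : Prop :=
  ∀ ε : ℝ, 0 < ε → Tendsto (fun n => P n {ω | ε < |Z n ω - c|}) atTop (𝓝 0)

end GIRG

end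

/-! The count is a sum of clique indicators over the `k`-sets of vertices, and the proof is a
second-moment argument after truncation of the weights. The mean is `n.choose k` times the
probability that `k` independent vertices form a clique, and this probability can be evaluated at
two scales. Dividing the weights by `√(nμ)` removes the factor `nμ` from the edge probability and
leaves the integral J^NG, cut off at weights `w₀ / √(nμ)`, times a power of `n`
(`choose_mul_cliqueProb_scaled`). Keeping the weights and enlarging distances by `(nμ)^(1/d)`
unrolls the torus into the whole space and leaves J^G times `(nμ)^(-(k-1))` (`tendsto_torusInt`,
`tendsto_cliqueProb_spaceInt`).

Finiteness decides which scale is relevant. Keep only the edges of the star centred at the vertex of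
least weight. Integrating out a position bounds an edge between weights `u`, `v` by `C u v`, so the
star is bounded by a constant times the integral of `u^(-τ) (∫_u^∞ u v^(1-τ) dv)^(k-1)`, that is, of
`u^((3-τ)k - 3)`. This converges at infinity when `(3-τ)k < 2`, and at zero when `(3-τ)k > 2`; in
the latter case the bound by 1 on each edge controls large `u`. These are `lintegral_minStar_lt_top`
and `lintegral_minStar_min_lt_top`; the first also supplies the dominating function for the limit
towards J^G.

For concentration, only cliques with weights in a set `T` are kept: weights above `ε√(nμ)` in case
(i), weights at most `M` in case (ii). The truncation loses a fraction of the mean that is small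
with the parameter, which Markov's inequality handles. Among truncated cliques, disjoint pairs are
uncorrelated and intersecting pairs are few: a pair with union `U` contains a star on `U` centred at
a shared vertex, so its probability is at most `ν T * ρ^(|U| - 1)`, with `ρ` a bound on the
connection probability to a random vertex of `T` (`measure_cliqueEvent_inter_le`). Chebyshev's
inequality then applies, and `convergesInProbability_cliqueCount` combines both errors. -/

noncomputable section

namespace GIRG

/-! ### Product measures: Tonelli over stars, subfamilies and densities. -/

section Product

variable {E : Type*} [MeasurableSpace E]

/-- Tonelli's theorem for products of functions of one coordinate each. -/
theorem lintegral_pi_prod : ∀ {n : ℕ} (ν : Measure E) [SigmaFinite ν] (f : Fin n → E → ℝ≥0∞)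
    (_ : ∀ i, Measurable (f i)),
    ∫⁻ x, ∏ i, f i (x i) ∂(Measure.pi fun _ : Fin n => ν) = ∏ i, ∫⁻ y, f i y ∂ν := by
  intro n
  induction n with
  | zero =>
    intro ν _ f _
    simp
  | succ n ih =>
    intro ν _ f hf
    have h := (measurePreserving_piFinSuccAbove (fun _ : Fin (n + 1) => ν) 0).symm
    rw [← h.lintegral_comp_emb (MeasurableEquiv.measurableEmbedding _)]
    have h1 : ∀ a : E × (Fin n → E), (∏ i, f i
        ((MeasurableEquiv.piFinSuccAbove (fun _ : Fin (n + 1) => E) 0).symm a i)) =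
        f 0 a.1 * ∏ i : Fin n, f i.succ (a.2 i) := by
      intro a
      rw [Fin.prod_univ_succ]
      simp [MeasurableEquiv.piFinSuccAbove_symm_apply]
    simp_rw [h1]
    have h2 : Measurable fun y : Fin n → E => ∏ i : Fin n, f i.succ (y i) :=
      Finset.measurable_prod _ fun i _ => (hf _).comp (measurable_pi_apply i)
    rw [lintegral_prod_mul (hf 0).aemeasurable h2.aemeasurable,
      ih ν (fun i => f i.succ) fun i => hf _, Fin.prod_univ_succ]

/-- The integral of a product over the edges of a star, centred at the coordinate `c`. -/
theorem lintegral_pi_star {m : ℕ} (ν : Measure E) [SigmaFinite ν] (c : Fin (m + 1))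
    (f : E → ℝ≥0∞) (hf : Measurable f)
    (h : Fin m → E → E → ℝ≥0∞) (hh : ∀ j, Measurable (Function.uncurry (h j))) :
    ∫⁻ x, f (x c) * ∏ j, h j (x c) (x (c.succAbove j))
      ∂(Measure.pi fun _ : Fin (m + 1) => ν) = ∫⁻ u, f u * ∏ j, ∫⁻ v, h j u v ∂ν ∂ν := by
  have hp := (measurePreserving_piFinSuccAbove (fun _ : Fin (m + 1) => ν) c).symm
  rw [← hp.lintegral_comp_emb (MeasurableEquiv.measurableEmbedding _)]
  simp only [MeasurableEquiv.piFinSuccAbove_symm_apply, Fin.insertNthEquiv_apply,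
    Fin.insertNth_apply_same, Fin.insertNth_apply_succAbove]
  rw [lintegral_prod]
  · refine lintegral_congr fun u => ?_
    simp only []
    rw [lintegral_const_mul, lintegral_pi_prod ν (fun j => h j u)]
    · exact fun j => (hh j).comp measurable_prodMk_left
    · exact Finset.measurable_prod _ fun j _ =>
        ((hh j).comp measurable_prodMk_left).comp (measurable_pi_apply j)
  · refine Measurable.aemeasurable ((hf.comp measurable_fst).mul
      (Finset.measurable_prod _ fun j _ => ?_))
    exact (hh j).comp (measurable_fst.prodMk ((measurable_pi_apply j).comp measurable_snd))

/-- The law of a subfamily of an i.i.d. family. -/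
theorem measurePreserving_pi_comp {n k : ℕ} (ν : Measure E) [IsProbabilityMeasure ν]
    {f : Fin k → Fin n} (hf : Function.Injective f) :
    MeasurePreserving (fun x : Fin n → E => x ∘ f) (Measure.pi fun _ => ν)
      (Measure.pi fun _ => ν) := by
  have h : iIndepFun (fun (i : Fin n) (x : Fin n → E) => x i) (Measure.pi fun _ => ν) :=
    iIndepFun_pi (X := fun _ => id) fun _ => aemeasurable_id
  refine ⟨measurable_pi_lambda _ fun i => measurable_pi_apply _, ?_⟩
  have h1 := (iIndepFun_iff_map_fun_eq_pi_map
    fun i => (measurable_pi_apply (f i)).aemeasurable).1 (h.precomp hf)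
  refine h1.trans ?_
  congr 1
  funext i
  exact (measurePreserving_eval (fun _ : Fin n => ν) (f i)).map_eq

/-- Functions of disjoint sets of coordinates of an i.i.d. family are independent. -/
theorem lintegral_pi_mul_of_disjoint {n k l : ℕ} (ν : Measure E) [IsProbabilityMeasure ν]
    {f : Fin k → Fin n} {g : Fin l → Fin n} (hf : Function.Injective f)
    (hg : Function.Injective g) (hfg : ∀ i j, f i ≠ g j)
    {F : (Fin k → E) → ℝ≥0∞} {H : (Fin l → E) → ℝ≥0∞} (hF : Measurable F) (hH : Measurable H) :
    ∫⁻ x, F (x ∘ f) * H (x ∘ g) ∂(Measure.pi fun _ : Fin n => ν) =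
      (∫⁻ y, F y ∂(Measure.pi fun _ => ν)) * ∫⁻ y, H y ∂(Measure.pi fun _ => ν) := by
  have h : iIndepFun (fun (i : Fin n) (x : Fin n → E) => x i) (Measure.pi fun _ => ν) :=
    iIndepFun_pi (X := fun _ => id) fun _ => aemeasurable_id
  have hd : Disjoint (Finset.univ.image f) (Finset.univ.image g) := by
    rw [Finset.disjoint_left]
    intro a ha ha'
    simp only [Finset.mem_image, Finset.mem_univ, true_and] at ha ha'
    obtain ⟨i, rfl⟩ := ha
    obtain ⟨j, hj⟩ := ha'
    exact hfg i j hj.symm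
  have h2 := h.indepFun_finset _ _ hd fun i => measurable_pi_apply i
  let f' : ({i // i ∈ Finset.univ.image f} → E) → Fin k → E :=
    fun x i => x ⟨f i, Finset.mem_image_of_mem _ (Finset.mem_univ i)⟩
  let g' : ({i // i ∈ Finset.univ.image g} → E) → Fin l → E :=
    fun x i => x ⟨g i, Finset.mem_image_of_mem _ (Finset.mem_univ i)⟩
  have hf' : Measurable f' := measurable_pi_lambda _ fun i => measurable_pi_apply _
  have hg' : Measurable g' := measurable_pi_lambda _ fun i => measurable_pi_apply _
  have h3 := h2.comp (hF.comp hf') (hH.comp hg')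
  have mf := measurePreserving_pi_comp ν hf
  have mg := measurePreserving_pi_comp ν hg
  have h4 := lintegral_mul_eq_lintegral_mul_lintegral_of_indepFun
    (f := fun x : Fin n → E => F (x ∘ f)) (g := fun x : Fin n → E => H (x ∘ g))
    (hF.comp mf.measurable) (hH.comp mg.measurable) h3
  refine h4.trans ?_
  rw [mf.lintegral_comp hF, mg.lintegral_comp hH]

theorem pi_withDensity {n : ℕ} (ν : Measure E) [SigmaFinite ν] (f : E → ℝ≥0∞)
    (hf : Measurable f) [SigmaFinite (ν.withDensity f)] :
    (Measure.pi fun _ : Fin n => ν.withDensity f) =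
      (Measure.pi fun _ : Fin n => ν).withDensity fun x => ∏ i, f (x i) := by
  refine Measure.pi_eq fun s hs => ?_
  rw [withDensity_apply _ (MeasurableSet.univ_pi hs),
    ← lintegral_indicator (MeasurableSet.univ_pi hs)]
  have h : ∀ x : Fin n → E, (univ.pi s).indicator (fun x => ∏ i, f (x i)) x =
      ∏ i, (s i).indicator f (x i) := by
    intro x
    by_cases hx : x ∈ univ.pi s
    · rw [indicator_of_mem hx]
      exact Finset.prod_congr rfl fun i _ => (indicator_of_mem (hx i (mem_univ i)) f).symm
    · rw [indicator_of_notMem hx]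
      simp only [mem_univ_pi, not_forall] at hx
      obtain ⟨i, hi⟩ := hx
      exact (Finset.prod_eq_zero (Finset.mem_univ i) (indicator_of_notMem hi f)).symm
  simp_rw [h]
  rw [lintegral_pi_prod ν (fun i => (s i).indicator f) fun i => hf.indicator (hs i)]
  refine Finset.prod_congr rfl fun i _ => ?_
  rw [withDensity_apply _ (hs i), lintegral_indicator (hs i)]

theorem pi_smul {n : ℕ} (ν : Measure E) [SigmaFinite ν] (c : ℝ≥0∞)
    [SigmaFinite (c • ν)] :
    (Measure.pi fun _ : Fin n => c • ν) = c ^ n • (Measure.pi fun _ : Fin n => ν) := by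
  refine Measure.pi_eq fun s hs => ?_
  simp [Measure.pi_pi, Finset.prod_mul_distrib]

end Product

/-! ### Edge sets of cliques, stars inside them, and intersecting pairs. -/

section Combinatorics

/-- The pairs of elements of `S`, in increasing order. -/
def pairs {n : ℕ} (S : Finset (Fin n)) : Finset (Fin n × Fin n) :=
  (S ×ˢ S).filter fun e => e.1 < e.2

theorem mem_pairs {n : ℕ} {S : Finset (Fin n)} {e : Fin n × Fin n} :
    e ∈ pairs S ↔ e.1 ∈ S ∧ e.2 ∈ S ∧ e.1 < e.2 := by
  simp [pairs, and_assoc]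

theorem isClique_iff_pairs {n : ℕ} (G : SimpleGraph (Fin n)) (S : Finset (Fin n)) :
    G.IsClique (S : Set (Fin n)) ↔ ∀ e ∈ pairs S, G.Adj e.1 e.2 := by
  constructor
  · intro h e he
    rw [mem_pairs] at he
    exact h he.1 he.2.1 he.2.2.ne
  · intro h u hu v hv huv
    rcases lt_or_gt_of_ne huv with h1 | h1
    · exact h (u, v) (mem_pairs.2 ⟨hu, hv, h1⟩)
    · exact (h (v, u) (mem_pairs.2 ⟨hv, hu, h1⟩)).symm

theorem prod_pairs {M : Type*} [CommMonoid M] {n k : ℕ} (S : Finset (Fin n)) (hS : S.card = k)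
    (F : Fin n → Fin n → M) :
    ∏ e ∈ pairs S, F e.1 e.2 =
      ∏ i, ∏ j ∈ Finset.Ioi i, F (S.orderEmbOfFin hS i) (S.orderEmbOfFin hS j) := by
  rw [Finset.prod_sigma']
  symm
  refine Finset.prod_bij (fun a _ => (S.orderEmbOfFin hS a.1, S.orderEmbOfFin hS a.2))
    ?_ ?_ ?_ ?_
  · rintro ⟨i, j⟩ h
    simp only [Finset.mem_sigma, Finset.mem_univ, Finset.mem_Ioi, true_and] at h
    exact mem_pairs.2 ⟨Finset.orderEmbOfFin_mem _ _ _, Finset.orderEmbOfFin_mem _ _ _, by simpa⟩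
  · rintro ⟨i, j⟩ _ ⟨i', j'⟩ _ h
    simp only [Prod.mk.injEq, EmbeddingLike.apply_eq_iff_eq] at h
    rw [h.1, h.2]
  · rintro ⟨u, v⟩ h
    rw [mem_pairs] at h
    have hr := Finset.range_orderEmbOfFin S hS
    obtain ⟨i, hi⟩ : u ∈ Set.range (S.orderEmbOfFin hS) := by rw [hr]; exact h.1
    obtain ⟨j, hj⟩ : v ∈ Set.range (S.orderEmbOfFin hS) := by rw [hr]; exact h.2.1
    refine ⟨⟨i, j⟩, ?_, by simp [hi, hj]⟩
    have h3 := h.2.2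
    simp only [← hi, ← hj] at h3
    simpa using h3
  · rintro ⟨i, j⟩ _
    rfl

/-- A product over edges is at most the product over the edges of a star contained in it. -/
theorem prod_le_star {E : Type*} {φ : E → E → ℝ≥0∞} (hsymm : ∀ p q, φ p q = φ q p)
    (hle : ∀ p q, φ p q ≤ 1) {n : ℕ} (x : Fin n → E) (D : Finset (Fin n × Fin n)) (v : Fin n)
    (J : Finset (Fin n)) (hJ : ∀ u ∈ J, (min v u, max v u) ∈ D) :
    ∏ e ∈ D, φ (x e.1) (x e.2) ≤ ∏ u ∈ J, φ (x v) (x u) := by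
  classical
  -- Edges are stored in increasing order, so the star edge between `v` and `u` appears as this
  -- sorted pair; distinct leaves give distinct pairs.
  have hinj : Set.InjOn (fun u : Fin n => (min v u, max v u)) (J : Set (Fin n)) := by
    intro a _ b _ h
    simp only [Prod.mk.injEq] at h
    obtain ⟨h1, h2⟩ := h
    rcases le_total v a with h3 | h3 <;> rcases le_total v b with h4 | h4 <;>
      simp [h3, h4] at h1 h2 <;> order
  have h1 : ∏ u ∈ J, φ (x v) (x u) =
      ∏ e ∈ J.image (fun u : Fin n => (min v u, max v u)), φ (x e.1) (x e.2) := by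
    rw [Finset.prod_image hinj]
    refine Finset.prod_congr rfl fun u _ => ?_
    rcases le_total v u with h | h
    · simp [h]
    · simp [h, hsymm (x v)]
  rw [h1]
  refine Finset.prod_le_prod_of_subset_of_le_one' ?_ fun e _ _ => hle _ _
  intro e he
  rw [Finset.mem_image] at he
  obtain ⟨u, hu, rfl⟩ := he
  exact hJ u hu

theorem prod_Ioi_le_star {E : Type*} {φ : E → E → ℝ≥0∞} (hsymm : ∀ p q, φ p q = φ q p)
    (hle : ∀ p q, φ p q ≤ 1) {m : ℕ} (x : Fin (m + 1) → E) (c : Fin (m + 1)) :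
    ∏ i, ∏ j ∈ Finset.Ioi i, φ (x i) (x j) ≤ ∏ j, φ (x c) (x (c.succAbove j)) := by
  have h1 : ∏ i, ∏ j ∈ Finset.Ioi i, φ (x i) (x j) =
      ∏ e ∈ pairs Finset.univ, φ (x e.1) (x e.2) := by
    rw [prod_pairs Finset.univ (Finset.card_fin (m + 1)) fun u v => φ (x u) (x v)]
    have h2 : (Finset.univ : Finset (Fin (m + 1))).orderEmbOfFin (Finset.card_fin (m + 1)) =
        RelEmbedding.refl _ :=
      (Finset.orderEmbOfFin_unique' _ fun _ => Finset.mem_univ _).symm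
    rw [h2]
    rfl
  rw [h1]
  refine (prod_le_star hsymm hle x _ c (Finset.univ.image c.succAbove) ?_).trans_eq ?_
  · intro u hu
    rw [Finset.mem_image] at hu
    obtain ⟨j, _, rfl⟩ := hu
    refine mem_pairs.2 ⟨Finset.mem_univ _, Finset.mem_univ _, ?_⟩
    exact min_lt_max.2 (c.succAbove_ne j).symm
  · rw [Finset.prod_image Fin.succAbove_right_injective.injOn]

/-- The number of ordered pairs of intersecting `k`-sets, weighted by the size of their union. -/
theorem sum_intersecting_le {n k : ℕ} {t ρ β : ℝ} (ht : 0 ≤ t) (hρ : 0 ≤ ρ)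
    (hβ : 1 ≤ β) (hρβ : n * ρ ≤ β) :
    ∑ a ∈ ((Finset.powersetCard k (Finset.univ : Finset (Fin n))) ×ˢ
        (Finset.powersetCard k (Finset.univ : Finset (Fin n)))).filter
          (fun a => ¬ Disjoint a.1 a.2),
      t * ρ ^ ((a.1 ∪ a.2).card - 1) ≤ 2 * k * 16 ^ k * (n * t * β ^ (2 * k - 2)) := by
  classical
  set D := ((Finset.powersetCard k (Finset.univ : Finset (Fin n))) ×ˢ
        (Finset.powersetCard k (Finset.univ : Finset (Fin n)))).filter
          (fun a => ¬ Disjoint a.1 a.2) with hD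
  set V := (Finset.univ : Finset (Finset (Fin n))).filter
    (fun U => U.card ∈ Finset.Icc 1 (2 * k - 1)) with hV
  have hmaps : ∀ a ∈ D, a.1 ∪ a.2 ∈ V := by
    rintro ⟨S, S'⟩ h
    simp only [hD, Finset.mem_filter, Finset.mem_product, Finset.mem_powersetCard_univ] at h
    simp only [hV, Finset.mem_filter, Finset.mem_univ, true_and, Finset.mem_Icc]
    have h1 := Finset.card_union_add_card_inter S S'
    -- A common element gains one: the union has at most `2k - 1` elements, hence exponents of `β`
    -- stay at most `2k - 2`.
    have h2 : 0 < (S ∩ S').card := by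
      rw [Finset.card_pos, ← Finset.not_disjoint_iff_nonempty_inter]
      exact h.2
    have h3 : (S ∩ S').card ≤ S.card := Finset.card_le_card Finset.inter_subset_left
    omega
  rw [← Finset.sum_fiberwise_of_maps_to hmaps]
  -- Both sets are subsets of their union `U`, so at most `4 ^ |U|` ordered pairs share the same
  -- union.
  have h1 : ∀ U ∈ V, ∑ a ∈ D.filter (fun a => a.1 ∪ a.2 = U), t * ρ ^ ((a.1 ∪ a.2).card - 1)
      ≤ 4 ^ U.card * (t * ρ ^ (U.card - 1)) := by
    intro U _
    have h2 : ∑ a ∈ D.filter (fun a => a.1 ∪ a.2 = U), t * ρ ^ ((a.1 ∪ a.2).card - 1) =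
        ∑ a ∈ D.filter (fun a => a.1 ∪ a.2 = U), t * ρ ^ (U.card - 1) := by
      refine Finset.sum_congr rfl fun a ha => ?_
      rw [(Finset.mem_filter.1 ha).2]
    rw [h2, Finset.sum_const, nsmul_eq_mul]
    refine mul_le_mul_of_nonneg_right ?_ (by positivity)
    have h3 : (D.filter (fun a => a.1 ∪ a.2 = U)) ⊆ U.powerset ×ˢ U.powerset := by
      rintro ⟨S, S'⟩ h
      have h4 := (Finset.mem_filter.1 h).2
      simp only at h4
      simp only [Finset.mem_product, Finset.mem_powerset, ← h4]
      exact ⟨Finset.subset_union_left, Finset.subset_union_right⟩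
    have h4 := Finset.card_le_card h3
    rw [Finset.card_product, Finset.card_powerset, ← mul_pow] at h4
    exact_mod_cast h4
  refine (Finset.sum_le_sum h1).trans ?_
  have hmaps2 : ∀ U ∈ V, U.card ∈ Finset.Icc 1 (2 * k - 1) := fun U hU =>
    (Finset.mem_filter.1 hU).2
  rw [← Finset.sum_fiberwise_of_maps_to hmaps2]
  have h5 : ∀ m ∈ Finset.Icc 1 (2 * k - 1),
      ∑ U ∈ V.filter (fun U => U.card = m), (4 : ℝ) ^ U.card * (t * ρ ^ (U.card - 1)) ≤
        16 ^ k * (n * t * β ^ (2 * k - 2)) := by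
    intro m hm
    rw [Finset.mem_Icc] at hm
    have h6 : ∑ U ∈ V.filter (fun U => U.card = m), (4 : ℝ) ^ U.card * (t * ρ ^ (U.card - 1)) =
        ∑ U ∈ V.filter (fun U => U.card = m), (4 : ℝ) ^ m * (t * ρ ^ (m - 1)) :=
      Finset.sum_congr rfl fun U hU => by rw [(Finset.mem_filter.1 hU).2]
    rw [h6, Finset.sum_const, nsmul_eq_mul]
    have h7 : ((V.filter (fun U => U.card = m)).card : ℝ) ≤ (n : ℝ) ^ m := by
      have h8 : V.filter (fun U => U.card = m) ⊆ Finset.powersetCard m Finset.univ := by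
        intro U hU
        rw [Finset.mem_powersetCard_univ]
        exact (Finset.mem_filter.1 hU).2
      have h9 := Finset.card_le_card h8
      rw [Finset.card_powersetCard, Finset.card_fin] at h9
      exact_mod_cast h9.trans (Nat.choose_le_pow n m)
    -- There are at most `n ^ (l + 1)` unions of this size, each with `l` factors `ρ`: all but one
    -- factor `n` pair up into `(n ρ) ^ l`.
    obtain ⟨l, rfl⟩ : ∃ l, m = l + 1 := ⟨m - 1, by omega⟩
    have h10 : (4 : ℝ) ^ (l + 1) ≤ 16 ^ k := by
      rw [show (16 : ℝ) = 4 ^ 2 by norm_num, ← pow_mul]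
      exact pow_le_pow_right₀ (by norm_num) (by omega)
    have h11 : (n * ρ) ^ l ≤ β ^ (2 * k - 2) :=
      (pow_le_pow_left₀ (by positivity) hρβ l).trans (pow_le_pow_right₀ hβ (by omega))
    calc _ ≤ (n : ℝ) ^ (l + 1) * (4 ^ (l + 1) * (t * ρ ^ (l + 1 - 1))) := by gcongr
      _ = 4 ^ (l + 1) * (n * t * (n * ρ) ^ l) := by
        rw [Nat.add_sub_cancel]; ring
      _ ≤ _ := by gcongr
  refine (Finset.sum_le_sum h5).trans ?_
  rw [Finset.sum_const, nsmul_eq_mul, Nat.card_Icc, mul_assoc (2 * (k : ℝ))]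
  refine mul_le_mul_of_nonneg_right ?_ (by positivity)
  have : (2 * k - 1 + 1 - 1 : ℕ) ≤ 2 * k := by omega
  exact_mod_cast this

end Combinatorics

/-! ### Clique events and their conditional probabilities. -/

section CliqueWeight

variable {E Ω : Type*} {φ : E → E → ℝ≥0∞} {n k : ℕ} {T : Set E}

/-- The event that `S` is a clique whose points lie in `T`. -/
def cliqueEvent (p : Ω → Fin n → E) (G : Ω → SimpleGraph (Fin n)) (T : Set E)
    (S : Finset (Fin n)) : Set Ω :=
  {ω | (∀ v ∈ S, p ω v ∈ T) ∧ (G ω).IsClique (S : Set (Fin n))}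

/-- The conditional probability that `k` points in `T` form a clique. -/
def cliqueWeight (φ : E → E → ℝ≥0∞) (T : Set E) {k : ℕ} (x : Fin k → E) : ℝ≥0∞ :=
  (univ.pi fun _ => T).indicator (fun x => ∏ i, ∏ j ∈ Finset.Ioi i, φ (x i) (x j)) x

/-- The increasing enumeration of `S` lets every `k`-set share one function on `Fin k → E`, so that
all clique probabilities coincide. -/
theorem cliqueWeight_comp (S : Finset (Fin n)) (hS : S.card = k) (x : Fin n → E) :
    cliqueWeight φ T (x ∘ S.orderEmbOfFin hS) =
      {x : Fin n → E | ∀ v ∈ S, x v ∈ T}.indicator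
        (fun x => ∏ e ∈ pairs S, φ (x e.1) (x e.2)) x := by
  have h : x ∘ S.orderEmbOfFin hS ∈ (univ.pi fun _ => T) ↔
      x ∈ {x : Fin n → E | ∀ v ∈ S, x v ∈ T} := by
    simp only [mem_univ_pi, Function.comp_apply, mem_ofPred_eq]
    constructor
    · intro h v hv
      obtain ⟨i, rfl⟩ : v ∈ Set.range (S.orderEmbOfFin hS) := by
        rw [Finset.range_orderEmbOfFin]; exact hv
      exact h i
    · exact fun h i => h _ (Finset.orderEmbOfFin_mem _ _ _)
  unfold cliqueWeight
  by_cases hx : x ∈ {x : Fin n → E | ∀ v ∈ S, x v ∈ T}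
  · rw [indicator_of_mem hx, indicator_of_mem (h.2 hx),
      prod_pairs S hS fun u v => φ (x u) (x v)]
    rfl
  · rw [indicator_of_notMem hx, indicator_of_notMem (fun h' => hx (h.1 h'))]

end CliqueWeight

/-! ### Joint probabilities of cliques in a kernel graph. -/

section RandomGraph

variable {E : Type*} [MeasurableSpace E]

/-- `G` is a random graph on i.i.d. points `p` with law `ν`, in which, conditionally on the points,
the edges are independent and the edge `u v` is present with probability `φ (p u) (p v)`. -/
structure IsKernelGraph (ν : Measure E) (φ : E → E → ℝ≥0∞) (n : ℕ) {Ω : Type*}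
    [MeasurableSpace Ω] (P : Measure Ω) (p : Ω → Fin n → E) (G : Ω → SimpleGraph (Fin n)) :
    Prop where
  hasLaw : HasLaw p (Measure.pi fun _ : Fin n => ν) P
  measurableSet_adj : ∀ u v : Fin n, MeasurableSet {ω | (G ω).Adj u v}
  edges : ∀ D : Finset (Fin n × Fin n), (∀ e ∈ D, e.1 < e.2) →
    ∀ A : Set (Fin n → E), MeasurableSet A →
      P {ω | p ω ∈ A ∧ ∀ e ∈ D, (G ω).Adj e.1 e.2} =
        ∫⁻ x in A, ∏ e ∈ D, φ (x e.1) (x e.2) ∂(Measure.pi fun _ : Fin n => ν)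

/-- The probability that `k` independent points lie in `T` and form a clique. -/
def cliqueProb (ν : Measure E) (φ : E → E → ℝ≥0∞) (T : Set E) (k : ℕ) : ℝ≥0∞ :=
  ∫⁻ x, cliqueWeight φ T x ∂(Measure.pi fun _ : Fin k => ν)

variable {ν : Measure E} {φ : E → E → ℝ≥0∞} {n : ℕ} {Ω : Type*} [MeasurableSpace Ω]
  {P : Measure Ω} {p : Ω → Fin n → E} {G : Ω → SimpleGraph (Fin n)} {T : Set E} {k : ℕ}

theorem measurable_edge_prod (hφ : Measurable (Function.uncurry φ)) {ι : Type*}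
    (D : Finset (ι × ι)) :
    Measurable fun x : ι → E => ∏ e ∈ D, φ (x e.1) (x e.2) :=
  Finset.measurable_prod _ fun e _ =>
    show Measurable (Function.uncurry φ ∘ fun x : ι → E => (x e.1, x e.2)) from
      hφ.comp ((measurable_pi_apply e.1).prodMk (measurable_pi_apply e.2))

theorem measurable_clique_prod (hφ : Measurable (Function.uncurry φ)) (k : ℕ) :
    Measurable fun x : Fin k → E => ∏ i, ∏ j ∈ Finset.Ioi i, φ (x i) (x j) :=
  Finset.measurable_prod _ fun i _ => Finset.measurable_prod _ fun j _ =>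
    show Measurable (Function.uncurry φ ∘ fun x : Fin k → E => (x i, x j)) from
      hφ.comp ((measurable_pi_apply i).prodMk (measurable_pi_apply j))

theorem measurable_cliqueWeight (hφ : Measurable (Function.uncurry φ)) (hT : MeasurableSet T) :
    Measurable (cliqueWeight φ T (k := k)) :=
  (measurable_clique_prod hφ k).indicator (MeasurableSet.univ_pi fun _ => hT)

theorem measurableSet_points (hT : MeasurableSet T) (S : Finset (Fin n)) :
    MeasurableSet {x : Fin n → E | ∀ v ∈ S, x v ∈ T} := by
  have : {x : Fin n → E | ∀ v ∈ S, x v ∈ T} = (S : Set (Fin n)).pi fun _ => T := by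
    ext x; simp [Set.mem_pi]
  rw [this]
  exact MeasurableSet.pi (Set.to_countable _) fun _ _ => hT

namespace IsKernelGraph

variable (hG : IsKernelGraph ν φ n P p G)
include hG

/-- Only null-measurability is available, because `HasLaw` makes the points merely a.e. measurable.
-/
theorem nullMeasurableSet_cliqueEvent (hT : MeasurableSet T) (S : Finset (Fin n)) :
    NullMeasurableSet (cliqueEvent p G T S) P := by
  have h : cliqueEvent p G T S = p ⁻¹' {x | ∀ v ∈ S, x v ∈ T} ∩
      ⋂ e ∈ pairs S, {ω | (G ω).Adj e.1 e.2} := by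
    ext ω
    simp only [cliqueEvent, isClique_iff_pairs, mem_ofPred_eq, mem_inter_iff, mem_preimage,
      mem_iInter]
  rw [h]
  refine (hG.hasLaw.aemeasurable.nullMeasurableSet_preimage
    (measurableSet_points hT S)).inter (MeasurableSet.nullMeasurableSet ?_)
  exact Finset.measurableSet_biInter _ fun e _ => hG.measurableSet_adj _ _

/-- Two cliques together ask for one set of edges, the union of their pairs; an edge shared by both
is counted once. -/
theorem measure_cliqueEvent_inter (hT : MeasurableSet T) (S S' : Finset (Fin n)) :
    P (cliqueEvent p G T S ∩ cliqueEvent p G T S') =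
      ∫⁻ x in {x | ∀ v ∈ S ∪ S', x v ∈ T},
        ∏ e ∈ pairs S ∪ pairs S', φ (x e.1) (x e.2) ∂(Measure.pi fun _ : Fin n => ν) := by
  rw [← hG.edges _ (by
    intro e he
    rcases Finset.mem_union.1 he with h | h <;> exact (mem_pairs.1 h).2.2) _
    (measurableSet_points hT (S ∪ S'))]
  congr 1
  ext ω
  simp only [cliqueEvent, isClique_iff_pairs, mem_inter_iff, mem_ofPred_eq, Finset.mem_union,
    or_imp, forall_and]
  tauto

variable [IsProbabilityMeasure ν]

theorem measure_cliqueEvent (hφ : Measurable (Function.uncurry φ)) (hT : MeasurableSet T)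
    {S : Finset (Fin n)} (hS : S.card = k) :
    P (cliqueEvent p G T S) = cliqueProb ν φ T k := by
  have h := hG.measure_cliqueEvent_inter hT S S
  rw [inter_self, Finset.union_self, Finset.union_self,
    ← lintegral_indicator (measurableSet_points hT S)] at h
  rw [h, cliqueProb, ← (measurePreserving_pi_comp (n := n) ν
    (S.orderEmbOfFin hS).injective).lintegral_comp (measurable_cliqueWeight hφ hT)]
  exact lintegral_congr fun x => (cliqueWeight_comp S hS x).symm

theorem measure_cliqueEvent_inter_of_disjoint (hφ : Measurable (Function.uncurry φ))
    (hT : MeasurableSet T) {S S' : Finset (Fin n)} (hS : S.card = k) (hS' : S'.card = k)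
    (hd : Disjoint S S') :
    P (cliqueEvent p G T S ∩ cliqueEvent p G T S') = cliqueProb ν φ T k * cliqueProb ν φ T k := by
  rw [hG.measure_cliqueEvent_inter hT S S',
    ← lintegral_indicator (measurableSet_points hT (S ∪ S')), cliqueProb,
    ← lintegral_pi_mul_of_disjoint (n := n) ν (S.orderEmbOfFin hS).injective
      (S'.orderEmbOfFin hS').injective ?_ (measurable_cliqueWeight hφ hT)
      (measurable_cliqueWeight hφ hT)]
  · refine lintegral_congr fun x => ?_
    rw [cliqueWeight_comp S hS x, cliqueWeight_comp S' hS' x, ← Set.inter_indicator_mul]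
    have h1 : {x : Fin n → E | ∀ v ∈ S ∪ S', x v ∈ T} =
        {x | ∀ v ∈ S, x v ∈ T} ∩ {x | ∀ v ∈ S', x v ∈ T} := by
      ext x
      simp only [Finset.mem_union, or_imp, forall_and, mem_ofPred_eq, mem_inter_iff]
    have h2 : Disjoint (pairs S) (pairs S') := by
      rw [Finset.disjoint_left]
      intro e he he'
      exact Finset.disjoint_left.1 hd (mem_pairs.1 he).1 (mem_pairs.1 he').1
    rw [h1]
    congr 1
    funext x
    exact Finset.prod_union h2
  · intro i j hij
    refine Finset.disjoint_left.1 hd (Finset.orderEmbOfFin_mem S hS i) ?_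
    rw [hij]
    exact Finset.orderEmbOfFin_mem _ _ _

/-- A vertex `v` common to both cliques is adjacent to every other vertex of the union. Discarding
all other edges leaves a star, whose leaves are independent given the point of `v`: the centre costs
`ν T` and each leaf at most `ρ`. -/
theorem measure_cliqueEvent_inter_le (hφ : Measurable (Function.uncurry φ))
    (hsymm : ∀ x y, φ x y = φ y x) (hle : ∀ x y, φ x y ≤ 1)
    (hT : MeasurableSet T) {S S' : Finset (Fin n)} (hd : ¬ Disjoint S S') {ρ : ℝ≥0∞}
    (hρ : ∀ x ∈ T, ∫⁻ y in T, φ x y ∂ν ≤ ρ) :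
    P (cliqueEvent p G T S ∩ cliqueEvent p G T S') ≤ ν T * ρ ^ ((S ∪ S').card - 1) := by
  classical
  obtain ⟨v, hv, hv'⟩ := Finset.not_disjoint_iff.1 hd
  obtain ⟨m, rfl⟩ : ∃ m, n = m + 1 := ⟨n - 1, by have := v.pos; omega⟩
  set U := S ∪ S' with hU
  let f : E → ℝ≥0∞ := T.indicator 1
  -- Vertices outside the union receive the factor 1, so the star can be integrated over all `n`
  -- coordinates.
  let h : Fin m → E → E → ℝ≥0∞ := fun j x y =>
    if v.succAbove j ∈ U then T.indicator (fun y => φ x y) y else 1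
  have hf : Measurable f := measurable_one.indicator hT
  have hh : ∀ j, Measurable (Function.uncurry (h j)) := by
    intro j
    by_cases hj : v.succAbove j ∈ U
    · simp only [h, hj, if_true]
      exact hφ.indicator (measurable_snd hT)
    · simp only [h, hj, if_false]
      exact measurable_const
  rw [hG.measure_cliqueEvent_inter hT S S',
    ← lintegral_indicator (measurableSet_points hT (S ∪ S'))]
  have hUv : U.erase v = (Finset.univ.filter fun j => v.succAbove j ∈ U).image v.succAbove := by
    ext u
    simp only [Finset.mem_erase, Finset.mem_image, Finset.mem_filter, Finset.mem_univ, true_and]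
    constructor
    · rintro ⟨h1, h2⟩
      obtain ⟨j, rfl⟩ := Fin.exists_succAbove_eq h1
      exact ⟨j, h2, rfl⟩
    · rintro ⟨j, h1, rfl⟩
      exact ⟨v.succAbove_ne j, h1⟩
  have hcard : (Finset.univ.filter fun j => v.succAbove j ∈ U).card = U.card - 1 := by
    rw [← Finset.card_erase_of_mem (Finset.mem_union_left S' hv), hUv,
      Finset.card_image_of_injective _ Fin.succAbove_right_injective]
  calc _ ≤ ∫⁻ x, f (x v) * ∏ j, h j (x v) (x (v.succAbove j))
        ∂(Measure.pi fun _ : Fin (m + 1) => ν) := by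
        refine lintegral_mono fun x => ?_
        refine indicator_apply_le' (fun hx => ?_) fun _ => zero_le
        have h1 : f (x v) = 1 := by
          simp [f, hx v (Finset.mem_union_left _ hv)]
        have h2 : ∏ j, h j (x v) (x (v.succAbove j)) = ∏ u ∈ U.erase v, φ (x v) (x u) := by
          rw [hUv, Finset.prod_image Fin.succAbove_right_injective.injOn, Finset.prod_filter]
          refine Finset.prod_congr rfl fun j _ => ?_
          by_cases hj : v.succAbove j ∈ U
          · simp [h, hj, hx _ hj]
          · simp [h, hj]
        rw [h1, one_mul, h2]
        refine prod_le_star hsymm hle x _ v _ fun u hu => ?_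
        obtain ⟨huv, hu⟩ := Finset.mem_erase.1 hu
        have hlt : min v u < max v u := min_lt_max.2 huv.symm
        -- Since `v` lies in both sets, the edge to `u` belongs to whichever clique contains `u`.
        have key : ∀ R : Finset (Fin (m + 1)), v ∈ R → u ∈ R → (min v u, max v u) ∈ pairs R := by
          intro R h1 h2
          refine mem_pairs.2 ⟨?_, ?_, hlt⟩
          · rcases min_choice v u with h | h <;> simp only [h] <;> assumption
          · rcases max_choice v u with h | h <;> simp only [h] <;> assumption
        rcases Finset.mem_union.1 hu with h3 | h3
        · exact Finset.mem_union_left _ (key S hv h3)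
        · exact Finset.mem_union_right _ (key S' hv' h3)
    _ = ∫⁻ x, f x * ∏ j, ∫⁻ y, h j x y ∂ν ∂ν := lintegral_pi_star ν v f hf h hh
    _ ≤ ∫⁻ x, f x * ρ ^ (U.card - 1) ∂ν := by
        refine lintegral_mono fun x => ?_
        by_cases hx : x ∈ T
        · refine mul_le_mul_right ?_ _
          rw [← hcard, ← Finset.prod_const, Finset.prod_filter]
          refine Finset.prod_le_prod' fun j _ => ?_
          by_cases hj : v.succAbove j ∈ U
          · simp only [h, hj, if_true]
            rw [lintegral_indicator hT]
            exact hρ x hx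
          · simp [h, hj]
        · simp [f, hx]
    _ = _ := by
        rw [lintegral_mul_const _ hf]
        simp [f, lintegral_indicator_one hT]

end IsKernelGraph

end RandomGraph

/-! ### Truncated clique counts: moments and the general law of large numbers. -/

section Counts

section

variable {E Ω : Type*} {n : ℕ} {p : Ω → Fin n → E} {G : Ω → SimpleGraph (Fin n)} {T : Set E}
  {k : ℕ}

/-- The number of `k`-cliques whose points all lie in `T`. -/
def cliqueCountIn (p : Ω → Fin n → E) (G : Ω → SimpleGraph (Fin n)) (T : Set E) (k : ℕ)
    (ω : Ω) : ℝ :=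
  ∑ S ∈ Finset.powersetCard k (Finset.univ : Finset (Fin n)),
    (cliqueEvent p G T S).indicator 1 ω

theorem cliqueCountIn_univ (p : Ω → Fin n → E) (G : Ω → SimpleGraph (Fin n)) (k : ℕ) (ω : Ω) :
    cliqueCountIn p G univ k ω = cliqueCount k (G ω) := by
  classical
  have h : (G ω).cliqueSet k = (((Finset.powersetCard k (Finset.univ : Finset (Fin n))).filter
      fun S => (G ω).IsClique (S : Set (Fin n)) : Finset (Finset (Fin n))) :
      Set (Finset (Fin n))) := by
    ext S
    simp [SimpleGraph.isNClique_iff, and_comm]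
  rw [cliqueCount, h, Set.ncard_coe_finset, Finset.card_filter, cliqueCountIn]
  push_cast
  refine Finset.sum_congr rfl fun S _ => ?_
  simp [cliqueEvent, indicator_apply]

theorem cliqueCountIn_le_univ (ω : Ω) :
    cliqueCountIn p G T k ω ≤ cliqueCountIn p G univ k ω := by
  refine Finset.sum_le_sum fun S _ => ?_
  refine indicator_le_indicator_of_subset ?_ (fun _ => zero_le_one) _
  exact fun ω h => ⟨fun _ _ => mem_univ _, h.2⟩

end

variable {E : Type*} [MeasurableSpace E] {ν : Measure E} {φ : E → E → ℝ≥0∞} {n : ℕ}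
  {Ω : Type*} [MeasurableSpace Ω] {P : Measure Ω} {p : Ω → Fin n → E}
  {G : Ω → SimpleGraph (Fin n)} {T : Set E} {k : ℕ}

namespace IsKernelGraph

variable (hG : IsKernelGraph ν φ n P p G)
include hG

theorem aestronglyMeasurable_cliqueCountIn (hT : MeasurableSet T) :
    AEStronglyMeasurable (cliqueCountIn p G T k) P := by
  have h : cliqueCountIn p G T k =
      ∑ S ∈ Finset.powersetCard k (Finset.univ : Finset (Fin n)),
        (cliqueEvent p G T S).indicator (1 : Ω → ℝ) := by
    funext ω
    simp [cliqueCountIn]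
  rw [h]
  exact Finset.aestronglyMeasurable_sum _ fun S _ =>
    aestronglyMeasurable_one.indicator₀ (hG.nullMeasurableSet_cliqueEvent hT S)

variable [IsProbabilityMeasure P]

theorem memLp_cliqueCountIn (hT : MeasurableSet T) : MemLp (cliqueCountIn p G T k) 2 P := by
  refine MemLp.of_bound (hG.aestronglyMeasurable_cliqueCountIn hT)
    (Finset.powersetCard k (Finset.univ : Finset (Fin n))).card (Eventually.of_forall fun ω => ?_)
  refine (norm_sum_le _ _).trans ?_
  refine (Finset.sum_le_card_nsmul _ _ 1 fun S _ => ?_).trans_eq (by simp)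
  by_cases h : ω ∈ cliqueEvent p G T S <;> simp [h]

variable [IsProbabilityMeasure ν]

theorem integral_cliqueCountIn (hφ : Measurable (Function.uncurry φ)) (hT : MeasurableSet T) :
    ∫ ω, cliqueCountIn p G T k ω ∂P = n.choose k * (cliqueProb ν φ T k).toReal := by
  unfold cliqueCountIn
  rw [integral_finsetSum]
  · have h : ∀ S ∈ Finset.powersetCard k (Finset.univ : Finset (Fin n)),
        ∫ ω, (cliqueEvent p G T S).indicator 1 ω ∂P = (cliqueProb ν φ T k).toReal := by
      intro S hS
      rw [integral_indicator₀ (hG.nullMeasurableSet_cliqueEvent hT S)]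
      simp [Measure.real, hG.measure_cliqueEvent hφ hT (Finset.mem_powersetCard_univ.1 hS)]
    rw [Finset.sum_congr rfl h]
    simp
  · intro S _
    exact (integrable_const (1 : ℝ)).indicator₀ (hG.nullMeasurableSet_cliqueEvent hT S)

/-- The square is a sum over ordered pairs of `k`-sets. Disjoint pairs factorize and number at most
`(n.choose k) ^ 2`, giving at most the squared mean; the last term, from intersecting pairs,
therefore bounds the variance. -/
theorem integral_sq_cliqueCountIn_le (hφ : Measurable (Function.uncurry φ))
    (hsymm : ∀ x y, φ x y = φ y x) (hle : ∀ x y, φ x y ≤ 1) (hT : MeasurableSet T)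
    {t ρ β : ℝ} (ht : 0 ≤ t) (hνT : ν T ≤ ENNReal.ofReal t) (hρ0 : 0 ≤ ρ)
    (hρ : ∀ x ∈ T, ∫⁻ y in T, φ x y ∂ν ≤ ENNReal.ofReal ρ) (hβ : 1 ≤ β) (hρβ : n * ρ ≤ β) :
    ∫ ω, cliqueCountIn p G T k ω ^ 2 ∂P ≤
      (n.choose k * (cliqueProb ν φ T k).toReal) ^ 2 +
        2 * k * 16 ^ k * (n * t * β ^ (2 * k - 2)) := by
  classical
  set D := Finset.powersetCard k (Finset.univ : Finset (Fin n)) with hD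
  have h1 : ∀ ω, cliqueCountIn p G T k ω ^ 2 = ∑ a ∈ D ×ˢ D,
      (cliqueEvent p G T a.1 ∩ cliqueEvent p G T a.2).indicator (1 : Ω → ℝ) ω := by
    intro ω
    rw [sq, cliqueCountIn, Finset.sum_mul_sum, ← Finset.sum_product']
    refine Finset.sum_congr rfl fun a _ => ?_
    by_cases h : ω ∈ cliqueEvent p G T a.1 <;> by_cases h' : ω ∈ cliqueEvent p G T a.2 <;>
      simp [h, h']
  have h2 : ∀ a : Finset (Fin n) × Finset (Fin n),
      NullMeasurableSet (cliqueEvent p G T a.1 ∩ cliqueEvent p G T a.2) P := fun a =>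
    (hG.nullMeasurableSet_cliqueEvent hT a.1).inter (hG.nullMeasurableSet_cliqueEvent hT a.2)
  simp_rw [h1]
  rw [integral_finsetSum (D ×ˢ D) (f := fun a => (cliqueEvent p G T a.1 ∩
    cliqueEvent p G T a.2).indicator (1 : Ω → ℝ)) fun a _ =>
      (integrable_const (1 : ℝ)).indicator₀ (h2 a)]
  have h3 : ∀ a : Finset (Fin n) × Finset (Fin n),
      ∫ ω, (cliqueEvent p G T a.1 ∩ cliqueEvent p G T a.2).indicator (1 : Ω → ℝ) ω ∂P =
        (P (cliqueEvent p G T a.1 ∩ cliqueEvent p G T a.2)).toReal := by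
    intro a
    rw [integral_indicator₀ (h2 a)]
    simp [Measure.real]
  simp_rw [h3]
  rw [← Finset.sum_filter_add_sum_filter_not (D ×ˢ D) fun a => Disjoint a.1 a.2]
  refine add_le_add ?_ ((Finset.sum_le_sum fun a ha => ?_).trans
    (sum_intersecting_le (k := k) ht hρ0 hβ hρβ))
  · have h4 : ∀ a ∈ (D ×ˢ D).filter (fun a => Disjoint a.1 a.2),
        (P (cliqueEvent p G T a.1 ∩ cliqueEvent p G T a.2)).toReal =
          (cliqueProb ν φ T k).toReal * (cliqueProb ν φ T k).toReal := by
      intro a ha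
      obtain ⟨ha1, ha2⟩ := Finset.mem_filter.1 ha
      obtain ⟨ha3, ha4⟩ := Finset.mem_product.1 ha1
      rw [hG.measure_cliqueEvent_inter_of_disjoint hφ hT (Finset.mem_powersetCard_univ.1 ha3)
        (Finset.mem_powersetCard_univ.1 ha4) ha2, ENNReal.toReal_mul]
    rw [Finset.sum_congr rfl h4, Finset.sum_const, nsmul_eq_mul, mul_pow, ← sq]
    refine mul_le_mul_of_nonneg_right ?_ (by positivity)
    have h5 := Finset.card_le_card (Finset.filter_subset
      (fun a : Finset (Fin n) × Finset (Fin n) => Disjoint a.1 a.2) (D ×ˢ D))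
    rw [Finset.card_product, hD, Finset.card_powersetCard, Finset.card_fin, ← sq] at h5
    exact_mod_cast h5
  · have h6 := hG.measure_cliqueEvent_inter_le hφ hsymm hle hT (Finset.mem_filter.1 ha).2 hρ
    refine ENNReal.toReal_le_of_le_ofReal (by positivity) (h6.trans ?_)
    rw [ENNReal.ofReal_mul ht, ENNReal.ofReal_pow hρ0]
    gcongr

/-- Chebyshev's inequality controls the truncated count, and Markov's inequality the nonnegative
number of discarded cliques, whose mean is at most `2 δ a`. -/
theorem measure_abs_cliqueCount_sub_gt_le (hφ : Measurable (Function.uncurry φ))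
    (hsymm : ∀ x y, φ x y = φ y x) (hle : ∀ x y, φ x y ≤ 1) (hT : MeasurableSet T)
    {t ρ β : ℝ} (ht : 0 ≤ t) (hνT : ν T ≤ ENNReal.ofReal t) (hρ0 : 0 ≤ ρ)
    (hρ : ∀ x ∈ T, ∫⁻ y in T, φ x y ∂ν ≤ ENNReal.ofReal ρ) (hβ : 1 ≤ β) (hρβ : n * ρ ≤ β)
    {a c δ ε : ℝ} (ha : 0 < a) (hε : 0 < ε) (hδε : 4 * δ ≤ ε)
    (hub : n.choose k * (cliqueProb ν φ univ k).toReal ≤ (c + δ) * a)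
    (hlb : (c - δ) * a ≤ n.choose k * (cliqueProb ν φ T k).toReal) :
    P {ω | ε < |(cliqueCount k (G ω) : ℝ) / a - c|} ≤
      ENNReal.ofReal (2 * k * 16 ^ k * 16 / ε ^ 2 * (n * t * β ^ (2 * k - 2) / a ^ 2)) +
        ENNReal.ofReal (8 * δ / ε) := by
  set N := cliqueCountIn p G univ k with hN
  set M := cliqueCountIn p G T k with hM
  have hNL := hG.memLp_cliqueCountIn (k := k) MeasurableSet.univ
  have hML := hG.memLp_cliqueCountIn (k := k) hT
  have hNi : ∫ ω, N ω ∂P = _ := hG.integral_cliqueCountIn hφ MeasurableSet.univ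
  have hMi : ∫ ω, M ω ∂P = _ := hG.integral_cliqueCountIn hφ hT
  have hNint : Integrable N P := hNL.integrable (by norm_num)
  have hMint : Integrable M P := hML.integrable (by norm_num)
  -- The deviation budget `ε a` covers one `s` for the fluctuation of `M`, one for `N - M`, and `δ a
  -- ≤ s` for the error in the mean.
  set s := ε * a / 4 with hs
  have hs0 : 0 < s := by positivity
  have hsub : {ω | ε < |(cliqueCount k (G ω) : ℝ) / a - c|} ⊆
      {ω | s ≤ |M ω - ∫ ω, M ω ∂P|} ∪ {ω | s ≤ N ω - M ω} := by
    intro ω hω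
    rw [mem_ofPred_eq] at hω
    by_contra hcon
    simp only [mem_union, mem_ofPred_eq, not_or, not_le] at hcon
    have h1 : N ω = cliqueCount k (G ω) := cliqueCountIn_univ p G k ω
    have h2 : M ω ≤ N ω := cliqueCountIn_le_univ ω
    have h5 : ∫ ω, M ω ∂P ≤ ∫ ω, N ω ∂P :=
      integral_mono hMint hNint fun ω => cliqueCountIn_le_univ ω
    rw [← h1, div_sub' ha.ne', abs_div, abs_of_pos ha, lt_div_iff₀ ha] at hω
    have h3 := abs_lt.1 hcon.1
    have h6 : 4 * δ * a ≤ ε * a := mul_le_mul_of_nonneg_right hδε ha.le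
    rw [← hNi] at hub
    rw [← hMi] at hlb
    have h7 : |N ω - a * c| < ε * a := by
      rw [abs_lt]
      constructor <;> nlinarith [hcon.2]
    exact absurd hω (not_lt.2 h7.le)
  refine (measure_mono hsub).trans ((measure_union_le _ _).trans (add_le_add ?_ ?_))
  · refine (meas_ge_le_variance_div_sq hML hs0).trans (ENNReal.ofReal_le_ofReal ?_)
    have h1 := hG.integral_sq_cliqueCountIn_le (k := k) hφ hsymm hle hT ht hνT hρ0 hρ hβ hρβ
    rw [variance_eq_sub hML, hMi]
    rw [div_le_iff₀ (by positivity)]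
    have h2 : 2 * k * 16 ^ k * 16 / ε ^ 2 * (n * t * β ^ (2 * k - 2) / a ^ 2) * s ^ 2 =
        2 * k * 16 ^ k * (n * t * β ^ (2 * k - 2)) := by
      rw [hs]; field_simp; ring
    rw [h2]
    exact sub_le_iff_le_add'.2 h1
  · have h1 := mul_meas_ge_le_integral_of_nonneg (μ := P) (f := fun ω => N ω - M ω)
      (Eventually.of_forall fun ω => sub_nonneg.2 (cliqueCountIn_le_univ ω))
      (hNint.sub hMint) s
    rw [integral_sub hNint hMint, hNi, hMi] at h1
    rw [← ofReal_measureReal]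
    refine ENNReal.ofReal_le_ofReal ?_
    rw [le_div_iff₀ hε]
    have h2 : s * P.real {ω | s ≤ N ω - M ω} ≤ 2 * δ * a := by linarith
    rw [hs] at h2
    have h3 : (ε * P.real {ω | s ≤ N ω - M ω}) * a ≤ (8 * δ) * a := by
      rw [hs]; linarith
    have h4 := le_of_mul_le_mul_right h3 ha
    linarith

end IsKernelGraph

/-- A law of large numbers for the number of cliques of a random graph: it suffices to control
the mean, up to a truncation of the points for which the second moment is controlled. -/
theorem convergesInProbability_cliqueCount {E : Type*} [MeasurableSpace E] {ν : Measure E}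
    [IsProbabilityMeasure ν] {φ : ℕ → E → E → ℝ≥0∞} {Ω : ℕ → Type*}
    [∀ n, MeasurableSpace (Ω n)] (P : ∀ n, Measure (Ω n)) [∀ n, IsProbabilityMeasure (P n)]
    (p : ∀ n, Ω n → Fin n → E) (G : ∀ n, Ω n → SimpleGraph (Fin n))
    (hG : ∀ n, IsKernelGraph ν (φ n) n (P n) (p n) (G n))
    (hφ : ∀ n, Measurable (Function.uncurry (φ n)))
    (hsymm : ∀ n x y, φ n x y = φ n y x) (hle : ∀ n x y, φ n x y ≤ 1) (k : ℕ) (a : ℕ → ℝ)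
    (ha : ∀ᶠ n in atTop, 0 < a n) (c : ℝ)
    (H : ∀ δ : ℝ, 0 < δ → ∃ (T : ℕ → Set E) (t ρ β : ℕ → ℝ), (∀ n, MeasurableSet (T n)) ∧
      (∀ᶠ n : ℕ in atTop, 0 ≤ t n ∧ ν (T n) ≤ ENNReal.ofReal (t n) ∧ 0 ≤ ρ n ∧
        (∀ x ∈ T n, ∫⁻ y in T n, φ n x y ∂ν ≤ ENNReal.ofReal (ρ n)) ∧
        1 ≤ β n ∧ n * ρ n ≤ β n) ∧
      Tendsto (fun n : ℕ => n * t n * β n ^ (2 * k - 2) / a n ^ 2) atTop (𝓝 0) ∧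
      (∀ᶠ n : ℕ in atTop, n.choose k * (cliqueProb ν (φ n) univ k).toReal ≤ (c + δ) * a n) ∧
      (∀ᶠ n : ℕ in atTop, (c - δ) * a n ≤ n.choose k * (cliqueProb ν (φ n) (T n) k).toReal)) :
    ConvergesInProbability P (fun n ω => (cliqueCount k (G n ω) : ℝ) / a n) c := by
  intro ε hε
  rw [ENNReal.tendsto_nhds_zero]
  intro η hη
  obtain ⟨r, hr0, hrη⟩ : ∃ r : ℝ, 0 < r ∧ ENNReal.ofReal r ≤ η := by
    rcases eq_or_ne η ⊤ with h | h
    · exact ⟨1, one_pos, by simp [h]⟩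
    · exact ⟨η.toReal, ENNReal.toReal_pos hη.ne' h, by rw [ENNReal.ofReal_toReal h]⟩
  -- The first bound is the requirement `4 δ ≤ ε`; the second makes the Markov term `8 δ / ε` at
  -- most `r / 2`. The truncation depends on `δ`, so it is fixed before `n` grows.
  set δ := min (ε / 4) (ε * r / 16) with hδ
  have hδ0 : 0 < δ := by positivity
  obtain ⟨T, t, ρ, β, hT, h1, h2, h3, h4⟩ := H δ hδ0
  have h5 := (h2.const_mul (2 * k * 16 ^ k * 16 / ε ^ 2)).eventually
    (eventually_le_nhds (b := r / 2) (by rw [mul_zero]; positivity))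
  filter_upwards [h1, h3, h4, h5, ha] with n h1 h3 h4 h5 ha
  obtain ⟨ht, hνT, hρ0, hρ, hβ, hρβ⟩ := h1
  refine ((hG n).measure_abs_cliqueCount_sub_gt_le (hφ n) (hsymm n) (hle n) (hT n) ht hνT hρ0 hρ
    hβ hρβ ha hε ?_ h3 h4).trans (le_trans ?_ hrη)
  · have := min_le_left (ε / 4) (ε * r / 16)
    linarith
  · have h6 : 8 * δ / ε ≤ r / 2 := by
      rw [div_le_iff₀ hε]
      have := min_le_right (ε / 4) (ε * r / 16)
      linarith
    rw [show r = r / 2 + r / 2 by ring, ENNReal.ofReal_add (by positivity) (by positivity)]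
    exact add_le_add (ENNReal.ofReal_le_ofReal h5) (ENNReal.ofReal_le_ofReal h6)

end Counts

/-! ### The connection kernel: scaling and integrability. -/

section Kernel

variable {d : ℕ} {γ : ℝ}

theorem kernel_nonneg {a r : ℝ} (ha : 0 ≤ a) (hr : 0 ≤ r) : 0 ≤ kernel d γ a r :=
  le_min (Real.rpow_nonneg (div_nonneg ha (pow_nonneg hr d)) γ) zero_le_one

theorem kernel_div_pow (a r L : ℝ) : kernel d γ (a / L ^ d) r = kernel d γ a (L * r) := by
  rw [kernel, kernel, div_div, mul_pow]

@[fun_prop]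
theorem measurable_kernel {α : Type*} [MeasurableSpace α] {f g : α → ℝ} (hf : Measurable f)
    (hg : Measurable g) : Measurable fun x => kernel d γ (f x) (g x) := by
  unfold kernel
  exact ((hf.div (hg.pow_const d)).pow_const γ).min measurable_const

/-- The kernel as a connection function of marked points. -/
def connect (d : ℕ) (γ : ℝ) {V : Type*} [Norm V] [Sub V] (p q : ℝ × V) : ℝ≥0∞ :=
  ENNReal.ofReal (kernel d γ (p.1 * q.1) ‖p.2 - q.2‖)

theorem connect_le_one {V : Type*} [Norm V] [Sub V] (p q : ℝ × V) : connect d γ p q ≤ 1 :=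
  ENNReal.ofReal_le_one.2 (min_le_right _ _)

theorem connect_comm {V : Type*} [SeminormedAddCommGroup V] (p q : ℝ × V) :
    connect d γ p q = connect d γ q p := by
  unfold connect
  rw [mul_comm, norm_sub_rev]

theorem lintegral_comp_div {V : Type*} [NormedAddCommGroup V] [NormedSpace ℝ V]
    [MeasurableSpace V] [BorelSpace V] [FiniteDimensional ℝ V] (μ : Measure V)
    [μ.IsAddHaarMeasure] {f : V → ℝ≥0∞} (hf : Measurable f) {L : ℝ} (hL : 0 < L) :
    ∫⁻ z, f (L⁻¹ • z) ∂μ = ENNReal.ofReal (L ^ Module.finrank ℝ V) * ∫⁻ z, f z ∂μ := by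
  rw [← lintegral_map hf (measurable_const_smul L⁻¹),
    Measure.map_addHaar_smul μ (inv_ne_zero hL.ne'), lintegral_smul_measure, inv_pow, inv_inv,
    abs_of_pos (by positivity), smul_eq_mul]

/-- The integral of the kernel over the space, at unit scale. -/
theorem lintegral_kernel_one_lt_top (hd : 1 ≤ d) (hγ : 1 < γ) :
    ∫⁻ z : Fin d → ℝ, ENNReal.ofReal (kernel d γ 1 ‖z‖) < ⊤ := by
  have hd0 : (0 : ℝ) < d := by exact_mod_cast hd
  have h1 : ((Module.finrank ℝ (Fin d → ℝ) : ℕ) : ℝ) < d * γ := by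
    rw [Module.finrank_fin_fun]
    nlinarith
  have h2 := (integrable_one_add_norm (μ := (volume : Measure (Fin d → ℝ))) h1).const_mul
    ((2 : ℝ) ^ (d * γ))
  refine lt_of_le_of_lt (lintegral_mono fun z => ?_) h2.lintegral_lt_top
  refine ENNReal.ofReal_le_ofReal ?_
  have hz := norm_nonneg z
  -- The base `2 / (1 + ‖z‖)` is at least 1 inside the unit ball and at least `1 / ‖z‖` outside it,
  -- so it dominates both branches of the minimum.
  have h3 : (2 : ℝ) ^ (d * γ) * (1 + ‖z‖) ^ (-(d * γ)) = (2 / (1 + ‖z‖)) ^ (d * γ) := by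
    rw [Real.rpow_neg (by positivity), Real.div_rpow (by positivity) (by positivity)]
    rfl
  rw [h3]
  have hdγ : 0 ≤ d * γ := by positivity
  rcases le_total ‖z‖ 1 with h | h
  · refine (min_le_right _ _).trans (Real.one_le_rpow ?_ hdγ)
    rw [le_div_iff₀ (by positivity)]
    linarith
  · refine (min_le_left _ _).trans ?_
    rw [Real.rpow_mul (by positivity), Real.rpow_natCast]
    refine Real.rpow_le_rpow (by positivity) ?_ (by linarith)
    rw [div_pow, div_le_div_iff₀ (by positivity) (by positivity), one_mul, ← mul_pow]
    exact pow_le_pow_left₀ (by positivity) (by linarith) d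

/-- The integral of the kernel over the space. -/
theorem exists_lintegral_kernel_le (hd : 1 ≤ d) (hγ : 1 < γ) :
    ∃ C : ℝ, 0 < C ∧ ∀ a : ℝ, 0 ≤ a →
      ∫⁻ z : Fin d → ℝ, ENNReal.ofReal (kernel d γ a ‖z‖) ≤ ENNReal.ofReal (C * a) := by
  have hd0 : (d : ℝ) ≠ 0 := by positivity
  have hfin := lintegral_kernel_one_lt_top hd hγ
  set I := ∫⁻ z : Fin d → ℝ, ENNReal.ofReal (kernel d γ 1 ‖z‖) with hI
  refine ⟨I.toReal + 1, by positivity, fun a ha => ?_⟩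
  rcases ha.eq_or_lt with rfl | ha
  · have : ∀ z : Fin d → ℝ, kernel d γ 0 ‖z‖ = 0 := by
      intro z
      simp [kernel, Real.zero_rpow (show γ ≠ 0 by linarith)]
    simp [this]
  -- Dilating space by `a^(1/d)` reduces to `a = 1`; the Jacobian `L ^ d = a` gives linearity in
  -- `a`.
  · set L := a ^ ((d : ℝ)⁻¹) with hL
    have hL0 : 0 < L := by positivity
    have hLd : L ^ d = a := Real.rpow_inv_natCast_pow ha.le (by omega)
    have h1 : ∀ z : Fin d → ℝ, kernel d γ a ‖z‖ = kernel d γ 1 ‖L⁻¹ • z‖ := by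
      intro z
      rw [norm_smul, norm_inv, Real.norm_of_nonneg hL0.le, ← kernel_div_pow, inv_pow, hLd,
        one_div, inv_inv]
    simp_rw [h1]
    rw [lintegral_comp_div volume
      (f := fun z : Fin d → ℝ => ENNReal.ofReal (kernel d γ 1 ‖z‖)) (by fun_prop) hL0,
      Module.finrank_fin_fun, hLd, ← hI, mul_comm, ENNReal.ofReal_mul (by positivity)]
    gcongr
    refine (ENNReal.ofReal_toReal hfin.ne).symm.le.trans (ENNReal.ofReal_le_ofReal ?_)
    linarith

end Kernel

/-! ### The torus as a quotient of the unit cube. -/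

section TorusGeometry

variable {d : ℕ}

instance : IsProbabilityMeasure (volume : Measure UnitAddCircle) :=
  ⟨UnitAddCircle.measure_univ⟩

instance : IsProbabilityMeasure (volume : Measure (Torus d)) :=
  inferInstanceAs (IsProbabilityMeasure (Measure.pi fun _ : Fin d => volume))

instance {m : ℕ} : IsProbabilityMeasure (volume : Measure (Fin m → Torus d)) :=
  inferInstanceAs (IsProbabilityMeasure (Measure.pi fun _ : Fin m => (volume : Measure (Torus d))))

instance {m : ℕ} : (volume : Measure (Fin m → Torus d)).IsAddLeftInvariant :=
  Pi.isAddLeftInvariant_volume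

/-- The projection of the space onto the torus. -/
def toTorus (z : Fin d → ℝ) : Torus d := fun i => (z i : UnitAddCircle)

theorem toTorus_sub (y z : Fin d → ℝ) : toTorus (y - z) = toTorus y - toTorus z := by
  funext i
  simp [toTorus]

@[simp]
theorem toTorus_zero : toTorus (0 : Fin d → ℝ) = 0 := by
  funext i
  simp [toTorus]

@[fun_prop]
theorem measurable_toTorus : Measurable (toTorus (d := d)) :=
  measurable_pi_lambda _ fun i => AddCircle.measurable_mk'.comp (measurable_pi_apply i)

/-- No wrapping occurs within half a period in any coordinate. -/
theorem norm_toTorus {z : Fin d → ℝ} (hz : ‖z‖ ≤ 1 / 2) : ‖toTorus z‖ = ‖z‖ := by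
  have h : ∀ i, ‖toTorus z i‖ = ‖z i‖ := by
    intro i
    rw [toTorus, Real.norm_eq_abs]
    refine (AddCircle.norm_coe_eq_abs_iff (p := 1) one_ne_zero).2 ?_
    rw [abs_one, ← Real.norm_eq_abs]
    exact (norm_le_pi_norm z i).trans hz
  refine le_antisymm ?_ ?_
  · exact (pi_norm_le_iff_of_nonneg (norm_nonneg _)).2 fun i => (h i).le.trans (norm_le_pi_norm z i)
  · exact (pi_norm_le_iff_of_nonneg (norm_nonneg _)).2 fun i =>
      (h i).symm.le.trans (norm_le_pi_norm (toTorus z) i)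

/-- A fundamental domain of the torus. -/
def cube (d : ℕ) : Set (Fin d → ℝ) := univ.pi fun _ => Ioc (-(1 / 2)) (1 / 2)

theorem measurableSet_cube : MeasurableSet (cube d) :=
  MeasurableSet.univ_pi fun _ => measurableSet_Ioc

theorem norm_le_of_mem_cube {z : Fin d → ℝ} (hz : z ∈ cube d) : ‖z‖ ≤ 1 / 2 := by
  refine (pi_norm_le_iff_of_nonneg (by norm_num)).2 fun i => ?_
  have := hz i (mem_univ i)
  rw [Real.norm_eq_abs, abs_le]
  exact ⟨this.1.le, this.2⟩

theorem mem_cube_of_norm_lt {z : Fin d → ℝ} (hz : ‖z‖ < 1 / 2) : z ∈ cube d := by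
  intro i _
  have := abs_lt.1 ((norm_le_pi_norm z i).trans_lt hz)
  exact ⟨this.1, this.2.le⟩

theorem measurePreserving_toTorus :
    MeasurePreserving (toTorus (d := d)) (volume.restrict (cube d)) volume := by
  have h := measurePreserving_pi (fun _ : Fin d => volume.restrict (Ioc (-(1 / 2) : ℝ) (1 / 2)))
    (fun _ : Fin d => (volume : Measure UnitAddCircle))
    (f := fun _ (x : ℝ) => (x : UnitAddCircle)) fun _ => by
      have := UnitAddCircle.measurePreserving_mk (-(1 / 2))
      rwa [show -(1 / 2) + 1 = (1 / 2 : ℝ) by norm_num] at this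
  rw [← Measure.restrict_pi_pi] at h
  exact h

theorem measurePreserving_toTorus_pi (m : ℕ) :
    MeasurePreserving (fun (z : Fin m → Fin d → ℝ) i => toTorus (z i))
      (volume.restrict (univ.pi fun _ => cube d)) volume := by
  have h := measurePreserving_pi (fun _ : Fin m => volume.restrict (cube d))
    (fun _ : Fin m => (volume : Measure (Torus d))) (f := fun _ => toTorus)
    fun _ => measurePreserving_toTorus
  rw [← Measure.restrict_pi_pi] at h
  exact h

/-- A translation invariant function on the torus can be integrated with the first point fixed. -/
theorem lintegral_torus_root {m : ℕ} {F : (Fin (m + 1) → Torus d) → ℝ≥0∞} (hF : Measurable F)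
    (hinv : ∀ x (a : Torus d), F (fun i => x i + a) = F x) :
    ∫⁻ x, F x = ∫⁻ x : Fin m → Torus d, F (Fin.cons 0 x) := by
  have hp := (volume_preserving_piFinSuccAbove (fun _ : Fin (m + 1) => Torus d) 0).symm
  rw [← hp.lintegral_comp_emb (MeasurableEquiv.measurableEmbedding _)]
  have hmeas : Measurable fun a : Torus d × (Fin m → Torus d) =>
      F ((MeasurableEquiv.piFinSuccAbove (fun _ : Fin (m + 1) => Torus d) 0).symm a) :=
    hF.comp (MeasurableEquiv.measurable _)
  rw [Measure.volume_eq_prod, lintegral_prod _ hmeas.aemeasurable]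
  have h : ∀ a : Torus d, ∫⁻ x : Fin m → Torus d,
      F ((MeasurableEquiv.piFinSuccAbove (fun _ : Fin (m + 1) => Torus d) 0).symm (a, x)) =
      ∫⁻ x : Fin m → Torus d, F (Fin.cons 0 x) := by
    intro a
    -- Translating the other points by the first one moves the root to the origin.
    rw [← lintegral_add_right_eq_self _ (fun _ => a : Fin m → Torus d)]
    refine lintegral_congr fun x => ?_
    rw [← hinv (Fin.cons 0 x) a]
    congr 1
    funext i
    refine Fin.cases ?_ (fun i => ?_) i <;>
      simp [MeasurableEquiv.piFinSuccAbove_symm_apply, Fin.insertNthEquiv]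
  simp_rw [h]
  simp

end TorusGeometry

/-! ### Integrals over positions, on the torus and in the space. -/

section PositionIntegrals

variable {d : ℕ} {γ : ℝ}

/-- The probability that uniform points on the torus with weights `y` form a clique. -/
def torusInt (d : ℕ) (γ : ℝ) {k : ℕ} (y : Fin k → ℝ) : ℝ≥0∞ :=
  ∫⁻ x : Fin k → Torus d, ∏ i, ∏ j ∈ Finset.Ioi i, connect d γ (y i, x i) (y j, x j)

/-- The integral over the positions, in the space, of the vertices of a clique with weights `y`
of which one is at the origin. -/
def spaceInt (d : ℕ) (γ : ℝ) {k : ℕ} (y : Fin k → ℝ) : ℝ≥0∞ :=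
  ∫⁻ z : Fin (k - 1) → Fin d → ℝ,
    ∏ i, ∏ j ∈ Finset.Ioi i, connect d γ (y i, rooted z i) (y j, rooted z j)

theorem measurable_torusInt {k : ℕ} : Measurable (torusInt d γ (k := k)) := by
  refine Measurable.lintegral_prod_right'
    (f := fun a : (Fin k → ℝ) × (Fin k → Torus d) =>
      ∏ i, ∏ j ∈ Finset.Ioi i, connect d γ (a.1 i, a.2 i) (a.1 j, a.2 j)) ?_
  refine Finset.measurable_prod _ fun i _ => Finset.measurable_prod _ fun j _ => ?_
  unfold connect
  fun_prop

theorem measurable_rooted {k : ℕ} (i : Fin k) :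
    Measurable fun z : Fin (k - 1) → Fin d → ℝ => rooted z i := by
  unfold rooted
  by_cases h : (i : ℕ) = 0
  · simp only [h, dite_true]
    exact measurable_const
  · simp only [h, dite_false]
    exact measurable_pi_apply _

theorem measurable_spaceInt {k : ℕ} : Measurable (spaceInt d γ (k := k)) := by
  refine Measurable.lintegral_prod_right'
    (f := fun a : (Fin k → ℝ) × (Fin (k - 1) → Fin d → ℝ) =>
      ∏ i, ∏ j ∈ Finset.Ioi i, connect d γ (a.1 i, rooted a.2 i) (a.1 j, rooted a.2 j)) ?_
  refine Finset.measurable_prod _ fun i _ => Finset.measurable_prod _ fun j _ => ?_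
  have hi := measurable_rooted (d := d) i
  have hj := measurable_rooted (d := d) j
  unfold connect
  fun_prop

theorem rooted_eq_cons {m : ℕ} (z : Fin m → Fin d → ℝ) (i : Fin (m + 1)) :
    rooted (k := m + 1) z i = (Fin.cons 0 z : Fin (m + 1) → Fin d → ℝ) i := by
  refine Fin.cases ?_ (fun i => ?_) i
  · simp [rooted]
  · simp [rooted]

variable {C : ℝ}

/-- By translation invariance `u` may be the origin; the torus integral is then the space integral
restricted to the cube, where both norms agree. -/
theorem lintegral_torus_kernel_le
    (hC : ∀ a : ℝ, 0 ≤ a → ∫⁻ z : Fin d → ℝ, ENNReal.ofReal (kernel d γ a ‖z‖) ≤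
      ENNReal.ofReal (C * a)) {a : ℝ} (ha : 0 ≤ a) (u : Torus d) :
    ∫⁻ v : Torus d, ENNReal.ofReal (kernel d γ a ‖u - v‖) ≤ ENNReal.ofReal (C * a) := by
  have h0 : ∫⁻ v : Torus d, ENNReal.ofReal (kernel d γ a ‖u - v‖) =
      ∫⁻ v : Torus d, ENNReal.ofReal (kernel d γ a ‖v‖) := by
    simp_rw [norm_sub_rev u]
    exact lintegral_sub_right_eq_self (fun v : Torus d => ENNReal.ofReal (kernel d γ a ‖v‖)) u
  rw [h0, ← measurePreserving_toTorus.lintegral_comp (by fun_prop)]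
  refine le_trans ?_ ((setLIntegral_le_lintegral (cube d) _).trans (hC a ha))
  refine (setLIntegral_congr_fun measurableSet_cube fun z hz => ?_).le
  simp only [norm_toTorus (norm_le_of_mem_cube hz)]

/-- In a star the leaves integrate out one by one. The factor 1 in the minimum is what keeps J^NG
finite at large weights. -/
theorem torusInt_le_star
    (hC : ∀ a : ℝ, 0 ≤ a → ∫⁻ z : Fin d → ℝ, ENNReal.ofReal (kernel d γ a ‖z‖) ≤
      ENNReal.ofReal (C * a)) {m : ℕ} {y : Fin (m + 1) → ℝ} (hy : ∀ i, 0 ≤ y i)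
    (c : Fin (m + 1)) :
    torusInt d γ y ≤ ∏ j, min 1 (ENNReal.ofReal (C * (y c * y (c.succAbove j)))) := by
  let h : Fin m → Torus d → Torus d → ℝ≥0∞ := fun j u v =>
    ENNReal.ofReal (kernel d γ (y c * y (c.succAbove j)) ‖u - v‖)
  have hh : ∀ j, Measurable (Function.uncurry (h j)) := fun j => by
    have : Measurable fun a : Torus d × Torus d =>
      ENNReal.ofReal (kernel d γ (y c * y (c.succAbove j)) ‖a.1 - a.2‖) := by fun_prop
    exact this
  have h1 := lintegral_pi_star (volume : Measure (Torus d)) c 1 measurable_one h hh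
  simp only [Pi.one_apply, one_mul] at h1
  calc torusInt d γ y ≤ ∫⁻ x : Fin (m + 1) → Torus d, ∏ j, h j (x c) (x (c.succAbove j)) :=
        lintegral_mono fun x => prod_Ioi_le_star connect_comm connect_le_one
          (fun i => (y i, x i)) c
    _ = ∫⁻ u, ∏ j, ∫⁻ v, h j u v := h1
    _ ≤ ∫⁻ u : Torus d, ∏ j, min 1 (ENNReal.ofReal (C * (y c * y (c.succAbove j)))) := by
        refine lintegral_mono fun u => Finset.prod_le_prod' fun j _ => le_min ?_ ?_
        · refine (lintegral_mono fun v => ?_).trans_eq (by simp : ∫⁻ _ : Torus d, 1 = 1)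
          exact ENNReal.ofReal_le_one.2 (min_le_right _ _)
        · exact lintegral_torus_kernel_le hC (mul_nonneg (hy _) (hy _)) u
    _ = _ := by simp

/-- The rescaled torus integral, as an integral over a large cube. -/
theorem torusInt_div {m : ℕ} (y : Fin (m + 1) → ℝ) {s L : ℝ} (hL : 0 < L)
    (hLs : L ^ d = s ^ 2) :
    ENNReal.ofReal ((s ^ 2) ^ m) * torusInt d γ (fun i => y i / s) =
      ∫⁻ z : Fin m → Fin d → ℝ, (univ.pi fun _ => cube d).indicator
        (fun z => ∏ i : Fin (m + 1), ∏ j ∈ Finset.Ioi i, ENNReal.ofReal (kernel d γ (y i * y j)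
          (L * ‖toTorus (rooted (k := m + 1) z i - rooted (k := m + 1) z j)‖))) (L⁻¹ • z) := by
  have h1 : torusInt d γ (fun i => y i / s) = ∫⁻ x : Fin (m + 1) → Torus d,
      ∏ i, ∏ j ∈ Finset.Ioi i, ENNReal.ofReal (kernel d γ (y i * y j) (L * ‖x i - x j‖)) := by
    unfold torusInt connect
    refine lintegral_congr fun x => Finset.prod_congr rfl fun i _ =>
      Finset.prod_congr rfl fun j _ => ?_
    rw [← kernel_div_pow, hLs]
    congr 2
    ring
  have hmeas : Measurable fun x : Fin (m + 1) → Torus d =>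
      ∏ i, ∏ j ∈ Finset.Ioi i, ENNReal.ofReal (kernel d γ (y i * y j) (L * ‖x i - x j‖)) :=
    Finset.measurable_prod _ fun i _ => Finset.measurable_prod _ fun j _ => by fun_prop
  have hcons : Measurable fun x : Fin m → Torus d => (Fin.cons 0 x : Fin (m + 1) → Torus d) :=
    measurable_pi_lambda _ fun i => by
      refine Fin.cases ?_ (fun i => ?_) i
      · simp
      · simpa using measurable_pi_apply i
  have h3 := (measurePreserving_toTorus_pi m).lintegral_comp (hmeas.comp hcons)
  simp only [Function.comp_def] at h3
  rw [h1, lintegral_torus_root hmeas fun x a => by simp only [add_sub_add_right_eq_sub], ← h3,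
    ← lintegral_indicator (MeasurableSet.univ_pi fun _ => measurableSet_cube)]
  have h2 : ∀ (z : Fin m → Fin d → ℝ) (i : Fin (m + 1)),
      (Fin.cons 0 (fun i => toTorus (z i)) : Fin (m + 1) → Torus d) i =
        toTorus (rooted (k := m + 1) z i) := by
    intro z i
    rw [rooted_eq_cons]
    refine Fin.cases ?_ (fun i => ?_) i <;> simp
  simp_rw [h2, ← toTorus_sub]
  have hr := fun i => measurable_rooted (d := d) (k := m + 1) i
  let K : (Fin m → Fin d → ℝ) → ℝ≥0∞ := (univ.pi fun _ => cube d).indicator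
    fun z => ∏ i : Fin (m + 1), ∏ j ∈ Finset.Ioi i, ENNReal.ofReal (kernel d γ (y i * y j)
      (L * ‖toTorus (rooted (k := m + 1) z i - rooted (k := m + 1) z j)‖))
  have hK : Measurable K := by
    refine Measurable.indicator ?_ (MeasurableSet.univ_pi fun _ => measurableSet_cube)
    refine Finset.measurable_prod _ fun i _ => Finset.measurable_prod _ fun j _ => ?_
    have hi := hr i
    have hj := hr j
    fun_prop
  refine Eq.trans ?_ (lintegral_comp_div volume hK hL).symm
  congr 2
  rw [Module.finrank_pi_fintype]
  simp only [Module.finrank_fin_fun, Finset.sum_const, Finset.card_univ, Fintype.card_fin,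
    smul_eq_mul]
  rw [mul_comm, pow_mul, hLs]

theorem rooted_smul {k : ℕ} (a : ℝ) (z : Fin (k - 1) → Fin d → ℝ) (i : Fin k) :
    rooted (a • z) i = a • rooted z i := by
  unfold rooted
  split_ifs <;> simp

/-- With `L ^ d = s ^ 2`, one point is pinned at the origin and the other `m` are blown up by `L`;
the Jacobian `L ^ (d m)` is the prefactor. The cube then exhausts the space and torus distances
become Euclidean-space distances in the maximum norm. -/
theorem tendsto_torusInt (hd : 1 ≤ d)
    (hC : ∀ a : ℝ, 0 ≤ a → ∫⁻ z : Fin d → ℝ, ENNReal.ofReal (kernel d γ a ‖z‖) ≤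
      ENNReal.ofReal (C * a)) {m : ℕ} {y : Fin (m + 1) → ℝ} (hy : ∀ i, 0 ≤ y i) {s : ℕ → ℝ}
    (hs : Tendsto s atTop atTop) :
    Tendsto (fun n => ENNReal.ofReal ((s n ^ 2) ^ m) * torusInt d γ (fun i => y i / s n)) atTop
      (𝓝 (spaceInt d γ y)) := by
  set L : ℕ → ℝ := fun n => (s n ^ 2) ^ ((d : ℝ)⁻¹) with hLdef
  have hLd : ∀ n, L n ^ d = s n ^ 2 := fun n => Real.rpow_inv_natCast_pow (by positivity) (by omega)
  have hLtop : Tendsto L atTop atTop :=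
    (tendsto_rpow_atTop (by positivity)).comp ((tendsto_pow_atTop two_ne_zero).comp hs)
  let F : ℝ → (Fin m → Fin d → ℝ) → ℝ≥0∞ := fun L z => (univ.pi fun _ => cube d).indicator
        (fun z => ∏ i : Fin (m + 1), ∏ j ∈ Finset.Ioi i, ENNReal.ofReal (kernel d γ (y i * y j)
          (L * ‖toTorus (rooted (k := m + 1) z i - rooted (k := m + 1) z j)‖))) (L⁻¹ • z)
  have h1 : ∀ᶠ n in atTop, ENNReal.ofReal ((s n ^ 2) ^ m) * torusInt d γ (fun i => y i / s n) =
      ∫⁻ z, F (L n) z := by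
    filter_upwards [hLtop.eventually_gt_atTop 0] with n hn
    exact torusInt_div y hn (hLd n)
  refine Tendsto.congr' (h1.mono fun n hn => hn.symm) ?_
  -- The dominating function is the star centred at the pinned point. Its edges have length at most
  -- half a period before blow-up, so the wrapped norms are true norms there.
  let B : (Fin m → Fin d → ℝ) → ℝ≥0∞ := fun z =>
    ∏ j : Fin m, ENNReal.ofReal (kernel d γ (y 0 * y j.succ) ‖z j‖)
  have hBint : ∫⁻ z, B z ≠ ⊤ := by
    have h2 := lintegral_pi_prod (volume : Measure (Fin d → ℝ))
      (fun (j : Fin m) z => ENNReal.ofReal (kernel d γ (y 0 * y j.succ) ‖z‖))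
      fun j => by fun_prop
    refine ne_of_eq_of_ne h2 (ENNReal.prod_ne_top fun j _ => ?_)
    exact ((hC _ (mul_nonneg (hy _) (hy _))).trans_lt ENNReal.ofReal_lt_top).ne
  have hr := fun i => measurable_rooted (d := d) (k := m + 1) i
  refine tendsto_lintegral_filter_of_dominated_convergence B ?_ ?_ hBint ?_
  · refine Eventually.of_forall fun n => ?_
    refine (Measurable.indicator ?_ (MeasurableSet.univ_pi fun _ => measurableSet_cube)).comp
      (measurable_const_smul _)
    refine Finset.measurable_prod _ fun i _ => Finset.measurable_prod _ fun j _ => ?_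
    have hi := hr i
    have hj := hr j
    fun_prop
  · filter_upwards [hLtop.eventually_gt_atTop 0] with n hn
    refine Eventually.of_forall fun z => ?_
    refine indicator_apply_le' (fun hz => ?_) fun _ => zero_le
    let ψ : ℝ × (Fin d → ℝ) → ℝ × (Fin d → ℝ) → ℝ≥0∞ := fun p q =>
      ENNReal.ofReal (kernel d γ (p.1 * q.1) (L n * ‖toTorus (p.2 - q.2)‖))
    have hψ : ∀ p q, ψ p q = ψ q p := by
      intro p q
      simp only [ψ]
      rw [mul_comm p.1, toTorus_sub, toTorus_sub, norm_sub_rev]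
    refine (prod_Ioi_le_star hψ (fun p q => ENNReal.ofReal_le_one.2 (min_le_right _ _))
      (fun i => (y i, rooted (k := m + 1) ((L n)⁻¹ • z) i)) 0).trans_eq ?_
    refine Finset.prod_congr rfl fun j _ => ?_
    simp only [ψ, Fin.zero_succAbove, rooted_eq_cons, Fin.cons_zero, Fin.cons_succ]
    have hzj := norm_le_of_mem_cube (hz j (mem_univ j))
    rw [zero_sub, norm_toTorus (by rwa [norm_neg]), norm_neg, Pi.smul_apply, norm_smul, norm_inv,
      Real.norm_of_nonneg hn.le, mul_inv_cancel_left₀ hn.ne']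
  -- For fixed `z` the integrand is eventually constant: once `L n` exceeds twice all the norms,
  -- every point lies in the enlarged cube and no difference wraps around.
  · refine Eventually.of_forall fun z => ?_
    refine tendsto_const_nhds.congr' ?_
    have h3 : ∀ r : ℝ, ∀ᶠ n in atTop, r < L n / 2 := fun r =>
      (hLtop.atTop_div_const two_pos).eventually_gt_atTop r
    have h4 : ∀ᶠ n in atTop, ∀ i j : Fin (m + 1),
        ‖rooted (k := m + 1) z i - rooted (k := m + 1) z j‖ < L n / 2 := by
      rw [eventually_all]
      exact fun i => eventually_all.2 fun j => h3 _
    filter_upwards [hLtop.eventually_gt_atTop 0, h4, eventually_all.2 fun j => h3 ‖z j‖]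
      with n hn h5 h6
    have hz : (L n)⁻¹ • z ∈ univ.pi fun _ : Fin m => cube d := by
      intro j _
      refine mem_cube_of_norm_lt ?_
      rw [Pi.smul_apply, norm_smul, norm_inv, Real.norm_of_nonneg hn.le, inv_mul_lt_iff₀ hn]
      linarith [h6 j]
    refine Eq.trans ?_ (indicator_of_mem hz _).symm
    refine Finset.prod_congr rfl fun i _ => Finset.prod_congr rfl fun j _ => ?_
    rw [rooted_smul, rooted_smul, ← smul_sub, norm_toTorus, norm_smul, norm_inv,
      Real.norm_of_nonneg hn.le, mul_inv_cancel_left₀ hn.ne']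
    · rfl
    · rw [norm_smul, norm_inv, Real.norm_of_nonneg hn.le, inv_mul_le_iff₀ hn]
      linarith [h5 i j]

/-- Each of the `m` star edges contributes `1 / s ^ 2`, cancelling the prefactor exactly; the bound
is thus independent of `s` and serves for domination. -/
theorem torusInt_mul_pow_le
    (hC : ∀ a : ℝ, 0 ≤ a → ∫⁻ z : Fin d → ℝ, ENNReal.ofReal (kernel d γ a ‖z‖) ≤
      ENNReal.ofReal (C * a)) {m : ℕ} {y : Fin (m + 1) → ℝ} (hy : ∀ i, 0 ≤ y i)
    (c : Fin (m + 1)) {s : ℝ} (hs : 0 < s) :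
    ENNReal.ofReal ((s ^ 2) ^ m) * torusInt d γ (fun i => y i / s) ≤
      ∏ j, ENNReal.ofReal (C * (y c * y (c.succAbove j))) := by
  have h1 := torusInt_le_star hC (y := fun i => y i / s) (fun i => div_nonneg (hy i) hs.le) c
  have h2 : ENNReal.ofReal ((s ^ 2) ^ m) = ∏ _j : Fin m, ENNReal.ofReal (s ^ 2) := by
    rw [Finset.prod_const, Finset.card_fin, ENNReal.ofReal_pow (by positivity)]
  calc _ ≤ (∏ _j : Fin m, ENNReal.ofReal (s ^ 2)) *
        ∏ j, ENNReal.ofReal (C * (y c / s * (y (c.succAbove j) / s))) := by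
        rw [h2]
        exact mul_le_mul_right (h1.trans (Finset.prod_le_prod' fun j _ => min_le_right _ _)) _
    _ = _ := by
        rw [← Finset.prod_mul_distrib]
        refine Finset.prod_congr rfl fun j _ => ?_
        rw [← ENNReal.ofReal_mul (by positivity)]
        congr 1
        field_simp

/-- The bound passes to the limit from the torus, where every vertex may serve as centre; this
avoids moving the root in the space integral. -/
theorem spaceInt_le_star (hd : 1 ≤ d)
    (hC : ∀ a : ℝ, 0 ≤ a → ∫⁻ z : Fin d → ℝ, ENNReal.ofReal (kernel d γ a ‖z‖) ≤
      ENNReal.ofReal (C * a)) {m : ℕ} {y : Fin (m + 1) → ℝ} (hy : ∀ i, 0 ≤ y i)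
    (c : Fin (m + 1)) :
    spaceInt d γ y ≤ ∏ j, ENNReal.ofReal (C * (y c * y (c.succAbove j))) := by
  refine le_of_tendsto (tendsto_torusInt hd hC hy tendsto_natCast_atTop_atTop) ?_
  filter_upwards [eventually_gt_atTop 0] with n hn
  exact torusInt_mul_pow_le hC hy c (by exact_mod_cast hn)

end PositionIntegrals

/-! ### Power-law measures and the Pareto weights. -/

section Weights

variable {τ a : ℝ}

/-- The measure with density `y ^ (-τ)` on `(a, ∞)`. -/
def powMeasure (τ a : ℝ) : Measure ℝ :=
  (volume.restrict (Ioi a)).withDensity fun y => ENNReal.ofReal (y ^ (-τ))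

theorem measurable_ofReal_rpow (q : ℝ) : Measurable fun y : ℝ => ENNReal.ofReal (y ^ q) :=
  (measurable_id.pow_const q).ennreal_ofReal

instance : SigmaFinite (powMeasure τ a) :=
  SigmaFinite.withDensity_ofReal _

theorem lintegral_powMeasure {g : ℝ → ℝ≥0∞} (hg : Measurable g) :
    ∫⁻ y, g y ∂(powMeasure τ a) = ∫⁻ y in Ioi a, ENNReal.ofReal (y ^ (-τ)) * g y := by
  rw [powMeasure, lintegral_withDensity_eq_lintegral_mul _ (measurable_ofReal_rpow _) hg]
  rfl

theorem pi_powMeasure (k : ℕ) :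
    (Measure.pi fun _ : Fin k => powMeasure τ a) =
      (volume.restrict (univ.pi fun _ => Ioi a)).withDensity
        fun y => ∏ i, ENNReal.ofReal (y i ^ (-τ)) := by
  have : SigmaFinite ((volume.restrict (Ioi a)).withDensity
    fun y : ℝ => ENNReal.ofReal (y ^ (-τ))) := inferInstanceAs (SigmaFinite (powMeasure τ a))
  have h := pi_withDensity (n := k) (volume.restrict (Ioi a)) _ (measurable_ofReal_rpow (-τ))
  rw [← Measure.restrict_pi_pi] at h
  exact h

theorem lintegral_pi_powMeasure (ha : 0 ≤ a) {k : ℕ} {g : (Fin k → ℝ) → ℝ≥0∞}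
    (hg : Measurable g) :
    ∫⁻ y, g y ∂(Measure.pi fun _ : Fin k => powMeasure τ a) =
      ∫⁻ y in univ.pi (fun _ : Fin k => Ioi a), ENNReal.ofReal ((∏ i, y i) ^ (-τ)) * g y := by
  rw [pi_powMeasure, lintegral_withDensity_eq_lintegral_mul _ _ hg]
  · refine setLIntegral_congr_fun (MeasurableSet.univ_pi fun _ => measurableSet_Ioi) fun y hy => ?_
    have hy0 : ∀ i, 0 ≤ y i := fun i => ha.trans (le_of_lt (hy i (mem_univ i)))
    simp only [Pi.mul_apply]
    rw [← Real.finsetProd_rpow _ _ fun i _ => hy0 i,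
      ENNReal.ofReal_prod_of_nonneg fun i _ => Real.rpow_nonneg (hy0 i) _]
  · exact Finset.measurable_prod _ fun i _ =>
      (measurable_ofReal_rpow _).comp (measurable_pi_apply i)

theorem ae_pi_powMeasure (k : ℕ) :
    ∀ᵐ y ∂(Measure.pi fun _ : Fin k => powMeasure τ a), ∀ i, a < y i := by
  rw [pi_powMeasure]
  refine (withDensity_absolutelyContinuous _ _).ae_le ?_
  filter_upwards [ae_restrict_mem (MeasurableSet.univ_pi fun _ => measurableSet_Ioi)] with y hy i
  exact hy i (mem_univ i)

/-- Rescaling a power density. -/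
theorem map_div_powMeasure (ha : 0 ≤ a) {s : ℝ} (hs : 0 < s) :
    (powMeasure τ a).map (fun w => w / s) =
      ENNReal.ofReal (s ^ (1 - τ)) • powMeasure τ (a / s) := by
  refine Measure.ext fun A hA => ?_
  have hm : Measurable fun w : ℝ => w / s := measurable_id.div_const s
  rw [Measure.map_apply hm hA, Measure.smul_apply, smul_eq_mul, powMeasure, powMeasure,
    withDensity_apply _ (hm hA), withDensity_apply _ hA, Measure.restrict_restrict (hm hA),
    Measure.restrict_restrict hA, ← lintegral_indicator ((hm hA).inter measurableSet_Ioi),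
    ← lintegral_indicator (hA.inter measurableSet_Ioi)]
  set f : ℝ → ℝ≥0∞ :=
    (A ∩ Ioi (a / s)).indicator fun y => ENNReal.ofReal ((s * y) ^ (-τ)) with hf
  have hfm : Measurable f :=
    ((measurable_ofReal_rpow (-τ)).comp (measurable_const_mul s)).indicator
      (hA.inter measurableSet_Ioi)
  have h1 := lintegral_comp_div (volume : Measure ℝ) hfm hs
  rw [Module.finrank_self, pow_one] at h1
  have h2 : ∀ z, f (s⁻¹ • z) = (((fun w => w / s) ⁻¹' A) ∩ Ioi a).indicator
      (fun y => ENNReal.ofReal (y ^ (-τ))) z := by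
    intro z
    have h3 : s⁻¹ • z ∈ A ∩ Ioi (a / s) ↔ z ∈ ((fun w => w / s) ⁻¹' A) ∩ Ioi a := by
      simp only [smul_eq_mul, mem_inter_iff, mem_Ioi, mem_preimage]
      rw [inv_mul_eq_div, div_lt_div_iff_of_pos_right hs]
    by_cases hz : z ∈ ((fun w => w / s) ⁻¹' A) ∩ Ioi a
    · rw [hf, indicator_of_mem (h3.2 hz), indicator_of_mem hz, smul_eq_mul,
        mul_inv_cancel_left₀ hs.ne']
    · rw [hf, indicator_of_notMem (fun h => hz (h3.1 h)), indicator_of_notMem hz]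
  simp_rw [h2] at h1
  rw [h1, ← lintegral_const_mul _ hfm, ← lintegral_const_mul]
  · refine lintegral_congr fun y => ?_
    by_cases hy : y ∈ A ∩ Ioi (a / s)
    · have hy0 : 0 ≤ y := (div_nonneg ha hs.le).trans (le_of_lt hy.2)
      rw [hf, indicator_of_mem hy, indicator_of_mem hy, ← ENNReal.ofReal_mul hs.le,
        ← ENNReal.ofReal_mul (Real.rpow_nonneg hs.le _), Real.mul_rpow hs.le hy0, ← mul_assoc]
      congr 2
      rw [sub_eq_add_neg, Real.rpow_add hs, Real.rpow_one]
    · rw [hf, indicator_of_notMem hy, indicator_of_notMem hy, mul_zero, mul_zero]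
  · exact (measurable_ofReal_rpow _).indicator (hA.inter measurableSet_Ioi)

theorem lintegral_pi_powMeasure_div (ha : 0 ≤ a) {s : ℝ} (hs : 0 < s) {k : ℕ}
    {g : (Fin k → ℝ) → ℝ≥0∞} (hg : Measurable g) :
    ∫⁻ w, g (fun i => w i / s) ∂(Measure.pi fun _ : Fin k => powMeasure τ a) =
      ENNReal.ofReal (s ^ (1 - τ)) ^ k *
        ∫⁻ y, g y ∂(Measure.pi fun _ : Fin k => powMeasure τ (a / s)) := by
  have hm : Measurable fun w : ℝ => w / s := measurable_id.div_const s
  have h0 := map_div_powMeasure (τ := τ) ha hs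
  have hsf : SigmaFinite ((powMeasure τ a).map fun w => w / s) :=
    (MeasurableEquiv.mulRight₀ s⁻¹ (inv_ne_zero hs.ne')).sigmaFinite_map
  have hsf' : SigmaFinite (ENNReal.ofReal (s ^ (1 - τ)) • powMeasure τ (a / s)) := h0 ▸ hsf
  have h1 := Measure.pi_map_pi (μ := fun _ : Fin k => powMeasure τ a)
    (f := fun _ w => w / s) fun _ => hm.aemeasurable
  simp_rw [h0] at h1
  rw [pi_smul] at h1
  have h2 := lintegral_map (μ := Measure.pi fun _ : Fin k => powMeasure τ a) hg
    (measurable_pi_lambda (fun (w : Fin k → ℝ) i => w i / s)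
      fun i => hm.comp (measurable_pi_apply i))
  rw [← h2, h1, lintegral_smul_measure, smul_eq_mul]

theorem weightLaw_eq {w₀ : ℝ} (hτ : 1 ≤ τ) (hw₀ : 0 ≤ w₀) :
    weightLaw τ w₀ = ENNReal.ofReal ((τ - 1) * w₀ ^ (τ - 1)) • powMeasure τ w₀ := by
  have hc : 0 ≤ (τ - 1) * w₀ ^ (τ - 1) :=
    mul_nonneg (by linarith) (Real.rpow_nonneg hw₀ _)
  have h : paretoPDF w₀ (τ - 1) = (Ici w₀).indicator
      (ENNReal.ofReal ((τ - 1) * w₀ ^ (τ - 1)) • fun y : ℝ => ENNReal.ofReal (y ^ (-τ))) := by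
    funext x
    rw [paretoPDF_eq, indicator_apply]
    by_cases hx : w₀ ≤ x
    · rw [if_pos hx, if_pos (show x ∈ Ici w₀ from hx), Pi.smul_apply, smul_eq_mul,
        ← ENNReal.ofReal_mul hc, sub_add_cancel]
    · rw [if_neg hx, if_neg (show x ∉ Ici w₀ from hx), ENNReal.ofReal_zero]
  rw [weightLaw, paretoMeasure, h, withDensity_indicator measurableSet_Ici,
    withDensity_smul _ (measurable_ofReal_rpow _), powMeasure,
    Measure.restrict_congr_set Ioi_ae_eq_Ici]

theorem isProbabilityMeasure_weightLaw {w₀ : ℝ} (hτ : 1 < τ) (hw₀ : 0 < w₀) :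
    IsProbabilityMeasure (weightLaw τ w₀) :=
  isProbabilityMeasure_paretoMeasure hw₀ (sub_pos.2 hτ)

theorem pi_weightLaw {w₀ : ℝ} (hτ : 1 < τ) (hw₀ : 0 < w₀) (k : ℕ) :
    (Measure.pi fun _ : Fin k => weightLaw τ w₀) =
      ENNReal.ofReal ((τ - 1) * w₀ ^ (τ - 1)) ^ k •
        Measure.pi fun _ : Fin k => powMeasure τ w₀ := by
  have := isProbabilityMeasure_weightLaw hτ hw₀
  have h := weightLaw_eq hτ.le hw₀.le
  have : SigmaFinite (ENNReal.ofReal ((τ - 1) * w₀ ^ (τ - 1)) • powMeasure τ w₀) := by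
    rw [← h]
    infer_instance
  rw [h, pi_smul]

theorem lintegral_Ioi_rpow {p u : ℝ} (hp : p < -1) (hu : 0 < u) :
    ∫⁻ v in Ioi u, ENNReal.ofReal (v ^ p) = ENNReal.ofReal (u ^ (p + 1) / -(p + 1)) := by
  rw [← ofReal_integral_eq_lintegral_ofReal (integrableOn_Ioi_rpow_of_lt hp hu),
    integral_Ioi_rpow_of_lt hp hu, neg_div, div_neg]
  filter_upwards [ae_restrict_mem measurableSet_Ioi] with v hv
  exact Real.rpow_nonneg (hu.le.trans (le_of_lt hv)) _

theorem lintegral_Ioc_rpow_lt_top {q : ℝ} (hq : -1 < q) :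
    ∫⁻ v in Ioc (0 : ℝ) 1, ENNReal.ofReal (v ^ q) < ⊤ := by
  have h := (intervalIntegral.intervalIntegrable_rpow' (a := 0) (b := 1) hq).1
  exact h.lintegral_lt_top

/-- Dropping the cutoff `a` only enlarges the domain, so tail estimates hold uniformly in `a`,
including `a = 0`. -/
theorem setLIntegral_Ici_powMeasure_le {g : ℝ → ℝ≥0∞} (hg : Measurable g) (u : ℝ) :
    ∫⁻ v in Ici u, g v ∂(powMeasure τ a) ≤
      ∫⁻ v in Ioi u, ENNReal.ofReal (v ^ (-τ)) * g v := by
  rw [← lintegral_indicator measurableSet_Ici,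
    lintegral_powMeasure (hg.indicator measurableSet_Ici)]
  refine (setLIntegral_le_lintegral _ _).trans ?_
  rw [← setLIntegral_congr (Ioi_ae_eq_Ici (a := u)).symm, ← lintegral_indicator measurableSet_Ici]
  refine lintegral_mono fun v => ?_
  by_cases hv : v ∈ Ici u
  · rw [indicator_of_mem hv, indicator_of_mem hv]
  · rw [indicator_of_notMem hv, indicator_of_notMem hv, mul_zero]

theorem powMeasure_Ici_le (hτ : 1 < τ) {u : ℝ} (hu : 0 < u) :
    powMeasure τ a (Ici u) ≤ ENNReal.ofReal (u ^ (1 - τ) / (τ - 1)) := by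
  have h := setLIntegral_Ici_powMeasure_le (τ := τ) (a := a) (measurable_const (a := 1)) u
  rw [setLIntegral_one] at h
  refine h.trans ?_
  simp only [mul_one]
  rw [lintegral_Ioi_rpow (by linarith) hu]
  refine le_of_eq ?_
  congr 2 <;> ring_nf

/-- This is the cost of one leaf heavier than the centre `u`; the integral of `v^(1-τ)` over the
tail converges because `τ > 2`. -/
theorem setLIntegral_mul_powMeasure_le (hτ : 2 < τ) {C u : ℝ} (hC : 0 ≤ C) (hu : 0 < u) :
    ∫⁻ v in Ici u, ENNReal.ofReal (C * (u * v)) ∂(powMeasure τ a) ≤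
      ENNReal.ofReal (C / (τ - 2) * u ^ (3 - τ)) := by
  refine (setLIntegral_Ici_powMeasure_le (by fun_prop) u).trans ?_
  have h : ∀ v ∈ Ioi u, ENNReal.ofReal (v ^ (-τ)) * ENNReal.ofReal (C * (u * v)) =
      ENNReal.ofReal (C * u) * ENNReal.ofReal (v ^ (1 - τ)) := by
    intro v hv
    have hv0 : 0 < v := hu.trans hv
    rw [← ENNReal.ofReal_mul (Real.rpow_nonneg hv0.le _), ← ENNReal.ofReal_mul (by positivity),
      sub_eq_add_neg, Real.rpow_add hv0, Real.rpow_one]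
    congr 1
    ring
  rw [setLIntegral_congr_fun measurableSet_Ioi h,
    lintegral_const_mul _ (measurable_ofReal_rpow _), lintegral_Ioi_rpow (by linarith) hu,
    ← ENNReal.ofReal_mul (by positivity)]
  refine ENNReal.ofReal_le_ofReal (le_of_eq ?_)
  have h1 : u ^ (3 - τ) = u * u ^ (1 - τ + 1) := by
    rw [show 3 - τ = 1 + (1 - τ + 1) by ring, Real.rpow_add hu 1, Real.rpow_one]
  rw [h1, show -(1 - τ + 1) = τ - 2 by ring]
  ring

end Weights

/-! ### Stars centred at the least weight, and the critical clique size. -/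

section MinStar

theorem rpow_mul_pow_eq {τ K u : ℝ} (hK : 0 ≤ K) (hu : 0 < u) {m : ℕ} :
    ENNReal.ofReal (u ^ (-τ)) * ENNReal.ofReal (K * u ^ (3 - τ)) ^ m =
      ENNReal.ofReal (K ^ m) * ENNReal.ofReal (u ^ ((3 - τ) * m - τ)) := by
  rw [← ENNReal.ofReal_pow (by positivity), ← ENNReal.ofReal_mul (by positivity),
    ← ENNReal.ofReal_mul (by positivity), sub_eq_add_neg ((3 - τ) * m), Real.rpow_add hu,
    Real.rpow_mul hu.le, Real.rpow_natCast, mul_pow]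
  congr 1
  ring

/-- The sum over `c` of products over a star centred at `c`, restricted to the tuples whose
minimum is at `c`. -/
def minStar (h : ℝ → ℝ → ℝ≥0∞) {m : ℕ} (y : Fin (m + 1) → ℝ) : ℝ≥0∞ :=
  ∑ c, ∏ j, (Ici (y c)).indicator (h (y c)) (y (c.succAbove j))

theorem le_minStar {h : ℝ → ℝ → ℝ≥0∞} {m : ℕ} {y : Fin (m + 1) → ℝ} {x : ℝ≥0∞}
    (hx : ∀ c, x ≤ ∏ j, h (y c) (y (c.succAbove j))) : x ≤ minStar h y := by
  obtain ⟨c, hc⟩ := Finite.exists_min y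
  refine le_trans ?_ (Finset.single_le_sum (fun _ _ => zero_le) (Finset.mem_univ c))
  refine (hx c).trans_eq (Finset.prod_congr rfl fun j _ => ?_)
  exact (indicator_of_mem (show _ ∈ Ici (y c) from hc _) _).symm

theorem lintegral_minStar (ν : Measure ℝ) [SigmaFinite ν] {h : ℝ → ℝ → ℝ≥0∞}
    (hh : Measurable (Function.uncurry h)) (m : ℕ) :
    ∫⁻ y, minStar h y ∂(Measure.pi fun _ : Fin (m + 1) => ν) =
      (m + 1) * ∫⁻ u, (∫⁻ v in Ici u, h u v ∂ν) ^ m ∂ν := by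
  have hle : MeasurableSet {a : ℝ × ℝ | a.1 ≤ a.2} :=
    measurableSet_le measurable_fst measurable_snd
  have hm : Measurable (Function.uncurry fun u v : ℝ => (Ici u).indicator (h u) v) :=
    hh.indicator hle
  have hm' : ∀ c j, Measurable fun y : Fin (m + 1) → ℝ =>
      (Ici (y c)).indicator (h (y c)) (y (Fin.succAbove c j)) := fun c j =>
    show Measurable (Function.uncurry (fun u v : ℝ => (Ici u).indicator (h u) v) ∘
      fun y : Fin (m + 1) → ℝ => (y c, y (c.succAbove j))) from
      hm.comp ((measurable_pi_apply c).prodMk (measurable_pi_apply _))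
  unfold minStar
  rw [lintegral_finsetSum _ fun c _ => Finset.measurable_prod _ fun j _ => hm' c j]
  have h1 : ∀ c : Fin (m + 1), ∫⁻ y : Fin (m + 1) → ℝ,
      ∏ j, (Ici (y c)).indicator (h (y c)) (y (c.succAbove j)) ∂(Measure.pi fun _ => ν) =
      ∫⁻ u, (∫⁻ v in Ici u, h u v ∂ν) ^ m ∂ν := by
    intro c
    have h2 := lintegral_pi_star ν c 1 measurable_one
      (fun (_ : Fin m) u v => (Ici u).indicator (h u) v) fun _ => hm
    simp only [Pi.one_apply, one_mul, Finset.prod_const, Finset.card_fin] at h2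
    rw [h2]
    simp_rw [lintegral_indicator measurableSet_Ici]
  simp_rw [h1]
  simp

/-- With `m` leaves the exponent of the centre is `(3 - τ) m - τ`, and `hm` says precisely that it
is below `-1`, the condition for convergence at infinity. -/
theorem lintegral_minStar_lt_top {τ : ℝ} (hτ : 2 < τ) {w₀ C : ℝ} (hw₀ : 0 < w₀) (hC : 0 ≤ C)
    {m : ℕ} (hm : (3 - τ) * (m + 1) < 2) :
    ∫⁻ y, minStar (fun u v => ENNReal.ofReal (C * (u * v))) y
      ∂(Measure.pi fun _ : Fin (m + 1) => powMeasure τ w₀) < ⊤ := by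
  have hmeas : Measurable (Function.uncurry fun u v : ℝ => ENNReal.ofReal (C * (u * v))) := by
    have : Measurable fun a : ℝ × ℝ => ENNReal.ofReal (C * (a.1 * a.2)) := by fun_prop
    exact this
  rw [lintegral_minStar _ hmeas]
  refine ENNReal.mul_lt_top (by finiteness) ?_
  set K := C / (τ - 2) with hK
  have hK0 : 0 ≤ K := div_nonneg hC (by linarith)
  calc _ ≤ ∫⁻ u, ENNReal.ofReal (K * u ^ (3 - τ)) ^ m ∂(powMeasure τ w₀) := by
        refine lintegral_mono_ae ?_
        have h1 : ∀ᵐ u ∂(powMeasure τ w₀), w₀ < u :=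
          (withDensity_absolutelyContinuous _ _).ae_le (ae_restrict_mem measurableSet_Ioi)
        filter_upwards [h1] with u hu
        gcongr
        exact setLIntegral_mul_powMeasure_le hτ hC (hw₀.trans hu)
    _ = ∫⁻ u in Ioi w₀, ENNReal.ofReal (u ^ (-τ)) * ENNReal.ofReal (K * u ^ (3 - τ)) ^ m :=
        lintegral_powMeasure (by fun_prop)
    _ = ∫⁻ u in Ioi w₀, ENNReal.ofReal (K ^ m) * ENNReal.ofReal (u ^ ((3 - τ) * m - τ)) := by
        refine setLIntegral_congr_fun measurableSet_Ioi fun u hu => ?_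
        exact rpow_mul_pow_eq hK0 (hw₀.trans hu)
    _ < ⊤ := by
        rw [lintegral_const_mul _ (measurable_ofReal_rpow _),
          lintegral_Ioi_rpow (by linarith) hw₀]
        finiteness

/-- For a centre `u ≤ 1` the linear bound gives exponent `(3 - τ) m - τ > -1`, integrable at zero.
For `u > 1` the bound by 1 makes each leaf cost at most `1 / (τ - 1)`, and `u^(-τ)` alone is
integrable. -/
theorem lintegral_minStar_min_lt_top {τ : ℝ} (hτ : 2 < τ) {C : ℝ} (hC : 0 ≤ C)
    {m : ℕ} (hm : 2 < (3 - τ) * (m + 1)) :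
    ∫⁻ y, minStar (fun u v => min 1 (ENNReal.ofReal (C * (u * v)))) y
      ∂(Measure.pi fun _ : Fin (m + 1) => powMeasure τ 0) < ⊤ := by
  have hmeas : Measurable
      (Function.uncurry fun u v : ℝ => min 1 (ENNReal.ofReal (C * (u * v)))) := by
    have : Measurable fun a : ℝ × ℝ => min 1 (ENNReal.ofReal (C * (a.1 * a.2))) := by fun_prop
    exact this
  rw [lintegral_minStar _ hmeas]
  refine ENNReal.mul_lt_top (by finiteness) ?_
  set K := C / (τ - 2) with hK
  have hK0 : 0 ≤ K := div_nonneg hC (by linarith)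
  have hint : Measurable fun u => (∫⁻ v in Ici u, min 1 (ENNReal.ofReal (C * (u * v)))
      ∂(powMeasure τ 0)) ^ m := by
    refine Measurable.pow_const ?_ m
    simp_rw [← lintegral_indicator measurableSet_Ici]
    refine Measurable.lintegral_prod_right'
      (f := fun a : ℝ × ℝ => (Ici a.1).indicator
        (fun v => min 1 (ENNReal.ofReal (C * (a.1 * v)))) a.2) ?_
    exact hmeas.indicator (measurableSet_le measurable_fst measurable_snd)
  rw [lintegral_powMeasure hint, ← Ioc_union_Ioi_eq_Ioi (zero_le_one (α := ℝ)),
    lintegral_union measurableSet_Ioi (Ioc_disjoint_Ioi le_rfl)]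
  refine ENNReal.add_lt_top.2 ⟨?_, ?_⟩
  · calc _ ≤ ∫⁻ u in Ioc 0 1, ENNReal.ofReal (K ^ m) *
          ENNReal.ofReal (u ^ ((3 - τ) * m - τ)) := by
          refine setLIntegral_mono' measurableSet_Ioc fun u hu => ?_
          rw [← rpow_mul_pow_eq hK0 hu.1]
          gcongr
          exact (lintegral_mono fun v => min_le_right _ _).trans
            (setLIntegral_mul_powMeasure_le hτ hC hu.1)
      _ < ⊤ := by
          rw [lintegral_const_mul _ (measurable_ofReal_rpow _)]
          exact ENNReal.mul_lt_top ENNReal.ofReal_lt_top (lintegral_Ioc_rpow_lt_top (by linarith))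
  · calc _ ≤ ∫⁻ u in Ioi 1, ENNReal.ofReal (u ^ (-τ)) * ENNReal.ofReal (1 / (τ - 1)) ^ m := by
          refine setLIntegral_mono' measurableSet_Ioi fun u hu => ?_
          have hu : 1 < u := hu
          gcongr
          refine (lintegral_mono fun v => min_le_left _ _).trans ?_
          rw [setLIntegral_one]
          refine (powMeasure_Ici_le (by linarith) (by linarith)).trans ?_
          have : u ^ (1 - τ) ≤ 1 := Real.rpow_le_one_of_one_le_of_nonpos hu.le (by linarith)
          refine ENNReal.ofReal_le_ofReal ?_
          exact div_le_div_of_nonneg_right this (by linarith)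
      _ < ⊤ := by
          rw [lintegral_mul_const _ (measurable_ofReal_rpow _),
            lintegral_Ioi_rpow (by linarith) one_pos]
          finiteness

end MinStar

/-! ### The geometric random graph as a kernel graph, and the integrals J. -/

section Girg

variable {d : ℕ} {τ w₀ γ : ℝ}

/-- The law of the weight and the position of one vertex. -/
def vertexLaw (d : ℕ) (τ w₀ : ℝ) : Measure (ℝ × Torus d) := (weightLaw τ w₀).prod volume

/-- The natural scale of the weights in a graph on `n` vertices. -/
def weightScale (τ w₀ : ℝ) (n : ℕ) : ℝ := √(n * meanWeight τ w₀)

/-- The edge probability as a function of two weighted positions. -/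
def edgeConnect (d : ℕ) (τ w₀ γ : ℝ) (n : ℕ) (p q : ℝ × Torus d) : ℝ≥0∞ :=
  ENNReal.ofReal (edgeProb d τ w₀ γ n p.1 q.1 p.2 q.2)

theorem meanWeight_pos (hτ : 2 < τ) (hw₀ : 0 < w₀) : 0 < meanWeight τ w₀ := by
  rw [meanWeight_eq hτ hw₀]
  have : 0 < τ - 1 := by linarith
  have : 0 < τ - 2 := by linarith
  positivity

theorem sq_weightScale (hτ : 2 < τ) (hw₀ : 0 < w₀) (n : ℕ) :
    weightScale τ w₀ n ^ 2 = n * meanWeight τ w₀ :=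
  Real.sq_sqrt (mul_nonneg n.cast_nonneg (meanWeight_pos hτ hw₀).le)

theorem weightScale_pos (hτ : 2 < τ) (hw₀ : 0 < w₀) {n : ℕ} (hn : 0 < n) :
    0 < weightScale τ w₀ n :=
  Real.sqrt_pos.2 (mul_pos (by exact_mod_cast hn) (meanWeight_pos hτ hw₀))

theorem tendsto_weightScale (hτ : 2 < τ) (hw₀ : 0 < w₀) :
    Tendsto (weightScale τ w₀) atTop atTop :=
  Real.tendsto_sqrt_atTop.comp
    (tendsto_natCast_atTop_atTop.atTop_mul_const (meanWeight_pos hτ hw₀))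

theorem edgeConnect_eq (hτ : 2 < τ) (hw₀ : 0 < w₀) (n : ℕ) (p q : ℝ × Torus d) :
    edgeConnect d τ w₀ γ n p q = connect d γ (p.1 / weightScale τ w₀ n, p.2)
      (q.1 / weightScale τ w₀ n, q.2) := by
  rw [edgeConnect, edgeProb, connect, div_mul_div_comm, ← sq, sq_weightScale hτ hw₀]

theorem edgeConnect_comm (n : ℕ) (p q : ℝ × Torus d) :
    edgeConnect d τ w₀ γ n p q = edgeConnect d τ w₀ γ n q p := by
  rw [edgeConnect, edgeConnect, edgeProb, edgeProb, mul_comm p.1, norm_sub_rev]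

theorem edgeConnect_le_one (n : ℕ) (p q : ℝ × Torus d) : edgeConnect d τ w₀ γ n p q ≤ 1 :=
  ENNReal.ofReal_le_one.2 (min_le_right _ _)

theorem measurable_edgeConnect (n : ℕ) :
    Measurable (Function.uncurry (edgeConnect d τ w₀ γ n)) := by
  have : Measurable fun a : (ℝ × Torus d) × (ℝ × Torus d) => ENNReal.ofReal
      (kernel d γ (a.1.1 * a.2.1 / (n * meanWeight τ w₀)) ‖a.1.2 - a.2.2‖) := by fun_prop
  exact this

/-- A pair of independent families is regrouped into one i.i.d. family of marked points, and the
conditional edge law is transported along it. -/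
theorem IsGIRG.isKernelGraph {n : ℕ} {Ω : Type*} [MeasurableSpace Ω] {P : Measure Ω}
    {W : Ω → Fin n → ℝ} {X : Ω → Fin n → Torus d} {G : Ω → SimpleGraph (Fin n)}
    [IsProbabilityMeasure (weightLaw τ w₀)] (hG : IsGIRG d τ w₀ γ n P W X G) :
    IsKernelGraph (vertexLaw d τ w₀) (edgeConnect d τ w₀ γ n) n P
      (fun ω v => (W ω v, X ω v)) G := by
  have he := (measurePreserving_arrowProdEquivProdArrow ℝ (Torus d) (Fin n)
    (fun _ => weightLaw τ w₀) fun _ => volume).symm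
  have hlaw : HasLaw (fun ω v => (W ω v, X ω v))
      (Measure.pi fun _ : Fin n => vertexLaw d τ w₀) P := he.comp_hasLaw hG.hasLaw
  refine ⟨hlaw, hG.measurableSet_adj, fun D hD A hA => ?_⟩
  have h1 := hG.edges D hD _ (he.measurable hA)
  refine h1.trans ?_
  have hF : Measurable (A.indicator fun x : Fin n → ℝ × Torus d =>
      ∏ e ∈ D, edgeConnect d τ w₀ γ n (x e.1) (x e.2)) :=
    (measurable_edge_prod (measurable_edgeConnect n) D).indicator hA
  rw [← lintegral_indicator hA, ← hlaw.lintegral_comp hF.aemeasurable]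
  exact (lintegral_indicator₀ (hlaw.aemeasurable.nullMeasurableSet_preimage hA) _).symm

/-- The probability that `k` vertices with weights in `B` form a clique, as an integral over the
weights. -/
theorem cliqueProb_vertexLaw (hτ : 2 < τ) (hw₀ : 0 < w₀) (n k : ℕ) {B : Set ℝ}
    (hB : MeasurableSet B) :
    cliqueProb (vertexLaw d τ w₀) (edgeConnect d τ w₀ γ n) (Prod.fst ⁻¹' B) k =
      ENNReal.ofReal ((τ - 1) * w₀ ^ (τ - 1)) ^ k *
        ∫⁻ w, (univ.pi fun _ : Fin k => B).indicator
          (fun w => torusInt d γ fun i => w i / weightScale τ w₀ n) w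
          ∂(Measure.pi fun _ => powMeasure τ w₀) := by
  have := isProbabilityMeasure_weightLaw (show 1 < τ by linarith) hw₀
  have he := (measurePreserving_arrowProdEquivProdArrow ℝ (Torus d) (Fin k)
    (fun _ => weightLaw τ w₀) fun _ => volume).symm
  have hT : MeasurableSet (Prod.fst ⁻¹' B : Set (ℝ × Torus d)) := measurable_fst hB
  have hm := measurable_cliqueWeight (k := k)
    (measurable_edgeConnect (d := d) (τ := τ) (w₀ := w₀) (γ := γ) n) hT
  have h1 := he.lintegral_comp hm
  rw [cliqueProb]
  refine h1.symm.trans ?_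
  have h0 := hm.comp he.measurable
  simp only [Function.comp_def] at h0
  rw [lintegral_prod _ h0.aemeasurable, pi_weightLaw (by linarith) hw₀,
    lintegral_smul_measure, smul_eq_mul]
  congr 1
  refine lintegral_congr fun w => ?_
  have h2 : ∀ x : Fin k → Torus d, (MeasurableEquiv.arrowProdEquivProdArrow ℝ (Torus d)
      (Fin k)).symm (w, x) = fun i => (w i, x i) := fun x => rfl
  simp_rw [h2]
  by_cases hw : w ∈ univ.pi fun _ : Fin k => B
  · rw [indicator_of_mem hw, torusInt]
    refine lintegral_congr fun x => ?_
    have h3 : (fun i => (w i, x i)) ∈ univ.pi fun _ : Fin k =>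
      (Prod.fst ⁻¹' B : Set (ℝ × Torus d)) := hw
    rw [cliqueWeight, indicator_of_mem h3]
    simp_rw [edgeConnect_eq hτ hw₀]
  · rw [indicator_of_notMem hw]
    have h3 : ∀ x : Fin k → Torus d, (fun i => (w i, x i)) ∉ univ.pi fun _ : Fin k =>
      (Prod.fst ⁻¹' B : Set (ℝ × Torus d)) := fun x => hw
    simp_rw [cliqueWeight, indicator_of_notMem (h3 _)]
    simp

theorem lintegral_torusInt_powMeasure (k : ℕ) :
    ∫⁻ y, torusInt d γ y ∂(Measure.pi fun _ : Fin k => powMeasure τ 0) = JNG d k τ γ := by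
  rw [lintegral_pi_powMeasure le_rfl measurable_torusInt, JNG]
  refine setLIntegral_congr_fun (MeasurableSet.univ_pi fun _ => measurableSet_Ioi) fun y hy => ?_
  have hy0 : ∀ i, 0 ≤ y i := fun i => le_of_lt (hy i (mem_univ i))
  have hk : ∀ (x : Fin k → Torus d) i j, 0 ≤ kernel d γ (y i * y j) ‖x i - x j‖ :=
    fun x i j => kernel_nonneg (mul_nonneg (hy0 i) (hy0 j)) (norm_nonneg _)
  simp only [torusInt]
  rw [← lintegral_const_mul]
  · refine lintegral_congr fun x => ?_
    rw [ENNReal.ofReal_mul (Real.rpow_nonneg (Finset.prod_nonneg fun i _ => hy0 i) _),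
      ENNReal.ofReal_prod_of_nonneg fun i _ => Finset.prod_nonneg fun j _ => hk x i j]
    congr 1
    exact Finset.prod_congr rfl fun i _ => (ENNReal.ofReal_prod_of_nonneg fun j _ => hk x i j).symm
  · refine Finset.measurable_prod _ fun i _ => Finset.measurable_prod _ fun j _ => ?_
    unfold connect
    fun_prop

theorem lintegral_spaceInt_powMeasure (hw₀ : 0 ≤ w₀) (k : ℕ) :
    ∫⁻ y, spaceInt d γ y ∂(Measure.pi fun _ : Fin k => powMeasure τ w₀) = JG d k τ w₀ γ := by
  rw [lintegral_pi_powMeasure hw₀ measurable_spaceInt, JG]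
  refine setLIntegral_congr_fun (MeasurableSet.univ_pi fun _ => measurableSet_Ioi) fun y hy => ?_
  have hy0 : ∀ i, 0 ≤ y i := fun i => hw₀.trans (le_of_lt (hy i (mem_univ i)))
  have hk : ∀ (z : Fin (k - 1) → Fin d → ℝ) i j,
      0 ≤ kernel d γ (y i * y j) ‖rooted z i - rooted z j‖ :=
    fun x i j => kernel_nonneg (mul_nonneg (hy0 i) (hy0 j)) (norm_nonneg _)
  simp only [spaceInt]
  rw [← lintegral_const_mul]
  · refine lintegral_congr fun z => ?_
    rw [ENNReal.ofReal_mul (Real.rpow_nonneg (Finset.prod_nonneg fun i _ => hy0 i) _),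
      ENNReal.ofReal_prod_of_nonneg fun i _ => Finset.prod_nonneg fun j _ => hk z i j]
    congr 1
    exact Finset.prod_congr rfl fun i _ => (ENNReal.ofReal_prod_of_nonneg fun j _ => hk z i j).symm
  · refine Finset.measurable_prod _ fun i _ => Finset.measurable_prod _ fun j _ => ?_
    have hi := measurable_rooted (d := d) i
    have hj := measurable_rooted (d := d) j
    unfold connect
    fun_prop

theorem JNG_lt_top (hd : 1 ≤ d) (hτ : 2 < τ) (hγ : 1 < γ) {m : ℕ}
    (hm : 2 < (3 - τ) * (m + 1)) : JNG d (m + 1) τ γ < ⊤ := by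
  obtain ⟨C, hC0, hC⟩ := exists_lintegral_kernel_le hd hγ
  rw [← lintegral_torusInt_powMeasure]
  refine lt_of_le_of_lt (lintegral_mono_ae ?_) (lintegral_minStar_min_lt_top hτ hC0.le hm)
  filter_upwards [ae_pi_powMeasure (m + 1)] with y hy
  exact le_minStar fun c => torusInt_le_star hC (fun i => (hy i).le) c

theorem JG_lt_top (hd : 1 ≤ d) (hτ : 2 < τ) (hw₀ : 0 < w₀) (hγ : 1 < γ) {m : ℕ}
    (hm : (3 - τ) * (m + 1) < 2) : JG d (m + 1) τ w₀ γ < ⊤ := by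
  obtain ⟨C, hC0, hC⟩ := exists_lintegral_kernel_le hd hγ
  rw [← lintegral_spaceInt_powMeasure hw₀.le]
  refine lt_of_le_of_lt (lintegral_mono_ae ?_) (lintegral_minStar_lt_top hτ hw₀ hC0.le hm)
  filter_upwards [ae_pi_powMeasure (m + 1)] with y hy
  exact le_minStar fun c => spaceInt_le_star hd hC (fun i => (hw₀.trans (hy i)).le) c

theorem tendsto_choose_div_pow (k : ℕ) :
    Tendsto (fun n : ℕ => (n.choose k : ℝ) / (n : ℝ) ^ k) atTop (𝓝 (1 / k.factorial)) := by
  have h := (Asymptotics.isEquivalent_iff_tendsto_one ?_).1 (isEquivalent_choose k)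
  · have h2 := h.mul_const (1 / (k.factorial : ℝ))
    rw [one_mul] at h2
    refine h2.congr' ?_
    filter_upwards [eventually_gt_atTop 0] with n hn
    have hn' : (n : ℝ) ≠ 0 := by exact_mod_cast hn.ne'
    have := k.factorial_ne_zero
    simp only [Pi.div_apply]
    field_simp
  · filter_upwards [eventually_gt_atTop 0] with n hn
    have := k.factorial_ne_zero
    positivity

end Girg

/-! ### Asymptotic means and truncations in the two regimes. -/

section LawsOfLargeNumbers

variable {d : ℕ} {τ w₀ γ : ℝ}

theorem isProbabilityMeasure_vertexLaw (hτ : 2 < τ) (hw₀ : 0 < w₀) :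
    IsProbabilityMeasure (vertexLaw d τ w₀) := by
  have := isProbabilityMeasure_weightLaw (show 1 < τ by linarith) hw₀
  exact inferInstanceAs (IsProbabilityMeasure ((weightLaw τ w₀).prod volume))

theorem weightScale_rpow (hτ : 2 < τ) (hw₀ : 0 < w₀) (n : ℕ) (q : ℝ) :
    weightScale τ w₀ n ^ q = (n : ℝ) ^ (q / 2) * meanWeight τ w₀ ^ (q / 2) := by
  have hμ := (meanWeight_pos hτ hw₀).le
  rw [weightScale, Real.sqrt_eq_rpow, ← Real.rpow_mul (by positivity),
    Real.mul_rpow (by positivity) hμ]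
  congr 2 <;> ring

/-- The clique probability after rescaling the weights. -/
theorem cliqueProb_scaled (hτ : 2 < τ) (hw₀ : 0 < w₀) {n : ℕ} (hn : 0 < n) (k : ℕ) {B : Set ℝ}
    (hB : MeasurableSet B) :
    cliqueProb (vertexLaw d τ w₀) (edgeConnect d τ w₀ γ n)
        (Prod.fst ⁻¹' ((fun w => w / weightScale τ w₀ n) ⁻¹' B)) k =
      ENNReal.ofReal ((τ - 1) * w₀ ^ (τ - 1)) ^ k *
        (ENNReal.ofReal (weightScale τ w₀ n ^ (1 - τ)) ^ k *
          ∫⁻ y, (univ.pi fun _ : Fin k => B).indicator (torusInt d γ) y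
            ∂(Measure.pi fun _ => powMeasure τ (w₀ / weightScale τ w₀ n))) := by
  have hB' : MeasurableSet ((fun w : ℝ => w / weightScale τ w₀ n) ⁻¹' B) :=
    measurable_id.div_const _ hB
  rw [cliqueProb_vertexLaw hτ hw₀ n k hB',
    ← lintegral_pi_powMeasure_div hw₀.le (weightScale_pos hτ hw₀ hn)
      (measurable_torusInt.indicator (MeasurableSet.univ_pi fun _ => hB))]
  rfl

/-- Each rescaled weight density yields a factor `(nμ)^((1-τ)/2)`; together with one `n` per vertex
this gives the order `n^((3-τ)k/2)`. -/
theorem choose_mul_cliqueProb_scaled (hτ : 2 < τ) (hw₀ : 0 < w₀) {n : ℕ} (hn : 0 < n) (k : ℕ)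
    {B : Set ℝ} (hB : MeasurableSet B) :
    (n.choose k : ℝ) * (cliqueProb (vertexLaw d τ w₀) (edgeConnect d τ w₀ γ n)
        (Prod.fst ⁻¹' ((fun w => w / weightScale τ w₀ n) ⁻¹' B)) k).toReal =
      (n.choose k : ℝ) / (n : ℝ) ^ k * (((τ - 1) * w₀ ^ (τ - 1)) ^ k *
        (∫⁻ y, (univ.pi fun _ : Fin k => B).indicator (torusInt d γ) y
          ∂(Measure.pi fun _ => powMeasure τ (w₀ / weightScale τ w₀ n))).toReal /
        meanWeight τ w₀ ^ ((τ - 1) * k / 2)) * (n : ℝ) ^ ((3 - τ) * k / 2) := by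
  have hμ := meanWeight_pos hτ hw₀
  have hn' : (0 : ℝ) < n := by exact_mod_cast hn
  have hs := weightScale_pos hτ hw₀ hn
  have hL : 0 ≤ (τ - 1) * w₀ ^ (τ - 1) :=
    mul_nonneg (by linarith) (Real.rpow_nonneg hw₀.le _)
  rw [cliqueProb_scaled hτ hw₀ hn k hB, ENNReal.toReal_mul, ENNReal.toReal_mul,
    ENNReal.toReal_pow, ENNReal.toReal_pow, ENNReal.toReal_ofReal hL,
    ENNReal.toReal_ofReal (by positivity), ← Real.rpow_mul_natCast hs.le,
    weightScale_rpow hτ hw₀]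
  have h1 : (n : ℝ) ^ ((3 - τ) * k / 2) = (n : ℝ) ^ k * (n : ℝ) ^ ((1 - τ) * k / 2) := by
    rw [← Real.rpow_natCast, ← Real.rpow_add hn']
    congr 1
    ring
  have h2 : meanWeight τ w₀ ^ ((1 - τ) * k / 2) = (meanWeight τ w₀ ^ ((τ - 1) * k / 2))⁻¹ := by
    rw [← Real.rpow_neg hμ.le]
    congr 1
    ring
  rw [h1, h2]
  field_simp

theorem lintegral_pi_powMeasure_mono {a b : ℝ} (ha : 0 ≤ a) (hab : a ≤ b) {k : ℕ}
    {g : (Fin k → ℝ) → ℝ≥0∞} (hg : Measurable g) :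
    ∫⁻ y, g y ∂(Measure.pi fun _ : Fin k => powMeasure τ b) ≤
      ∫⁻ y, g y ∂(Measure.pi fun _ : Fin k => powMeasure τ a) := by
  rw [lintegral_pi_powMeasure ha hg, lintegral_pi_powMeasure (ha.trans hab) hg]
  exact lintegral_mono_set (Set.pi_mono fun _ _ => Ioi_subset_Ioi hab)

theorem lintegral_pi_powMeasure_indicator {a b : ℝ} (ha : 0 ≤ a) (hab : a ≤ b) {k : ℕ}
    {g : (Fin k → ℝ) → ℝ≥0∞} (hg : Measurable g) :
    ∫⁻ y, (univ.pi fun _ : Fin k => Ioi b).indicator g y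
        ∂(Measure.pi fun _ : Fin k => powMeasure τ a) =
      ∫⁻ y, g y ∂(Measure.pi fun _ : Fin k => powMeasure τ b) := by
  have hm : MeasurableSet (univ.pi fun _ : Fin k => Ioi b) :=
    MeasurableSet.univ_pi fun _ => measurableSet_Ioi
  rw [lintegral_pi_powMeasure ha (hg.indicator hm), lintegral_pi_powMeasure (ha.trans hab) hg]
  have h : ∀ y : Fin k → ℝ, ENNReal.ofReal ((∏ i, y i) ^ (-τ)) *
      (univ.pi fun _ : Fin k => Ioi b).indicator g y =
      (univ.pi fun _ : Fin k => Ioi b).indicator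
        (fun y => ENNReal.ofReal ((∏ i, y i) ^ (-τ)) * g y) y := by
    intro y
    by_cases hy : y ∈ univ.pi fun _ : Fin k => Ioi b
    · rw [indicator_of_mem hy, indicator_of_mem hy]
    · rw [indicator_of_notMem hy, indicator_of_notMem hy, mul_zero]
  simp_rw [h]
  rw [setLIntegral_indicator hm, inter_eq_left.2 (Set.pi_mono fun _ _ => Ioi_subset_Ioi hab)]

theorem tendsto_lintegral_torusInt_truncated {k : ℕ} (hJ : JNG d k τ γ < ⊤) :
    Tendsto (fun j : ℕ => (∫⁻ y, torusInt d γ y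
      ∂(Measure.pi fun _ : Fin k => powMeasure τ (1 / ((j : ℝ) + 1)))).toReal) atTop
      (𝓝 (JNG d k τ γ).toReal) := by
  refine (ENNReal.tendsto_toReal hJ.ne).comp ?_
  have h1 : ∀ j : ℕ, ∫⁻ y, torusInt d γ y
      ∂(Measure.pi fun _ : Fin k => powMeasure τ (1 / ((j : ℝ) + 1))) =
      ∫⁻ y, (univ.pi fun _ : Fin k => Ioi (1 / ((j : ℝ) + 1))).indicator (torusInt d γ) y
        ∂(Measure.pi fun _ : Fin k => powMeasure τ 0) := fun j =>
    (lintegral_pi_powMeasure_indicator le_rfl (by positivity) measurable_torusInt).symm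
  simp_rw [h1]
  rw [← lintegral_torusInt_powMeasure] at hJ ⊢
  refine tendsto_lintegral_of_dominated_convergence (torusInt d γ) (fun j => ?_) (fun j => ?_)
    hJ.ne ?_
  · exact measurable_torusInt.indicator (MeasurableSet.univ_pi fun _ => measurableSet_Ioi)
  · exact Eventually.of_forall fun y => indicator_le_self _ _ _
  · filter_upwards [ae_pi_powMeasure k] with y hy
    refine tendsto_const_nhds.congr' ?_
    have h2 : ∀ i, ∀ᶠ j : ℕ in atTop, 1 / ((j : ℝ) + 1) < y i := fun i =>
      (tendsto_one_div_add_atTop_nhds_zero_nat (𝕜 := ℝ)).eventually_lt_const (hy i)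
    filter_upwards [eventually_all.2 h2] with j hj
    exact (indicator_of_mem (show y ∈ univ.pi fun _ : Fin k => Ioi (1 / ((j : ℝ) + 1)) from
      fun i _ => hj i) _).symm

theorem vertexLaw_preimage_fst (hτ : 2 < τ) (hw₀ : 0 < w₀) {B : Set ℝ} (hB : MeasurableSet B) :
    vertexLaw d τ w₀ (Prod.fst ⁻¹' B) = weightLaw τ w₀ B := by
  have := isProbabilityMeasure_weightLaw (show 1 < τ by linarith) hw₀
  exact measurePreserving_fst.measure_preimage hB.nullMeasurableSet

theorem weightLaw_Ici_le (hτ : 2 < τ) (hw₀ : 0 < w₀) {u : ℝ} (hu : 0 < u) :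
    weightLaw τ w₀ (Ici u) ≤
      ENNReal.ofReal ((τ - 1) * w₀ ^ (τ - 1) * (u ^ (1 - τ) / (τ - 1))) := by
  have hL : 0 ≤ (τ - 1) * w₀ ^ (τ - 1) :=
    mul_nonneg (by linarith) (Real.rpow_nonneg hw₀.le _)
  rw [weightLaw_eq (by linarith) hw₀.le, Measure.smul_apply, smul_eq_mul, ENNReal.ofReal_mul hL]
  gcongr
  exact powMeasure_Ici_le (by linarith) hu

variable {Ω : ℕ → Type*} [∀ n, MeasurableSpace (Ω n)]
  (P : ∀ n, Measure (Ω n)) [∀ n, IsProbabilityMeasure (P n)]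
  (W : ∀ n, Ω n → Fin n → ℝ) (X : ∀ n, Ω n → Fin n → Torus d)
  (G : ∀ n, Ω n → SimpleGraph (Fin n))

/-- For large cliques the count is governed by vertices of weight of order `√n`. -/
theorem convergesInProbability_of_JNG (hτ : 2 < τ) (hτ' : τ < 3) (hw₀ : 0 < w₀) {k : ℕ}
    (hk : 1 ≤ k) (hJ : JNG d k τ γ < ⊤)
    (hG : ∀ n, IsGIRG d τ w₀ γ n (P n) (W n) (X n) (G n)) :
    ConvergesInProbability P
      (fun n ω => (cliqueCount k (G n ω) : ℝ) / (n : ℝ) ^ ((3 - τ) * (k : ℝ) / 2))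
      (((τ - 1) * w₀ ^ (τ - 1)) ^ k * (JNG d k τ γ).toReal /
        (meanWeight τ w₀ ^ ((τ - 1) * (k : ℝ) / 2) * (k.factorial : ℝ))) := by
  have := isProbabilityMeasure_weightLaw (show 1 < τ by linarith) hw₀
  have := isProbabilityMeasure_vertexLaw (d := d) hτ hw₀
  have hμ := meanWeight_pos hτ hw₀
  have hτ1 : 0 < τ - 1 := by linarith
  set Λ := (τ - 1) * w₀ ^ (τ - 1) with hΛ
  have hΛ0 : 0 < Λ := by positivity
  set M := meanWeight τ w₀ ^ ((τ - 1) * (k : ℝ) / 2) with hM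
  have hM0 : 0 < M := by positivity
  set s := weightScale τ w₀ with hs
  have hchoose := tendsto_choose_div_pow k
  have hlim : ∀ J : ℝ, Tendsto (fun n : ℕ => (n.choose k : ℝ) / (n : ℝ) ^ k * (Λ ^ k * J / M))
      atTop (𝓝 (Λ ^ k * J / (M * k.factorial))) := by
    intro J
    have h := hchoose.mul_const (Λ ^ k * J / M)
    rwa [one_div_mul_eq_div, div_div] at h
  refine convergesInProbability_cliqueCount P _ G (fun n => (hG n).isKernelGraph)
    measurable_edgeConnect edgeConnect_comm edgeConnect_le_one k _ ?_ _ fun δ hδ => ?_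
  · filter_upwards [eventually_gt_atTop 0] with n hn
    have : (0 : ℝ) < n := by exact_mod_cast hn
    positivity
  have h1 := ((tendsto_lintegral_torusInt_truncated hJ).const_mul (Λ ^ k)).div_const
    (M * k.factorial)
  obtain ⟨j, hj⟩ := (h1.eventually_const_lt (sub_lt_self _ hδ)).exists
  set ε : ℝ := 1 / ((j : ℝ) + 1) with hε
  have hε0 : 0 < ε := by positivity
  -- Here `t n` is the Pareto tail at `ε * s n`, and `κ` is the constant in `n * t n = κ
  -- n^((3-τ)/2)`, which bounds the expected number of vertices kept.
  set κ : ℝ := Λ * (ε ^ (1 - τ) * meanWeight τ w₀ ^ ((1 - τ) / 2) / (τ - 1)) with hκ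
  have hκ0 : 0 < κ := by positivity
  set t : ℕ → ℝ := fun n => Λ * ((ε * s n) ^ (1 - τ) / (τ - 1)) with ht
  have hnt : ∀ n : ℕ, 0 < n → n * t n = κ * (n : ℝ) ^ ((3 - τ) / 2) := by
    intro n hn
    have hn' : (0 : ℝ) < n := by exact_mod_cast hn
    have h2 : (n : ℝ) ^ ((3 - τ) / 2) = n * (n : ℝ) ^ ((1 - τ) / 2) := by
      rw [show (3 - τ) / 2 = 1 + (1 - τ) / 2 by ring, Real.rpow_add hn' 1, Real.rpow_one]
    simp only [ht, hκ]
    rw [Real.mul_rpow hε0.le (weightScale_pos hτ hw₀ hn).le, weightScale_rpow hτ hw₀, h2]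
    ring
  have hB : ∀ n, MeasurableSet ((fun w => w / s n) ⁻¹' Ioi ε) := fun n =>
    measurable_id.div_const _ measurableSet_Ioi
  have hνT : ∀ n : ℕ, 0 < n → vertexLaw d τ w₀ (Prod.fst ⁻¹' ((fun w => w / s n) ⁻¹' Ioi ε)) ≤
      ENNReal.ofReal (t n) := by
    intro n hn
    have hsn := weightScale_pos hτ hw₀ hn
    rw [vertexLaw_preimage_fst hτ hw₀ (hB n)]
    refine (measure_mono fun w hw => ?_).trans (weightLaw_Ici_le hτ hw₀ (mul_pos hε0 hsn))
    exact ((lt_div_iff₀ hsn).1 hw).le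
  -- The trivial bound of edges by 1 suffices, so `ρ = t`. Adding 1 to `κ` ensures `1 ≤ β n`.
  refine ⟨fun n => Prod.fst ⁻¹' ((fun w => w / s n) ⁻¹' Ioi ε), t, t,
    fun n => (κ + 1) * (n : ℝ) ^ ((3 - τ) / 2), fun n => measurable_fst (hB n), ?_, ?_, ?_, ?_⟩
  · filter_upwards [eventually_gt_atTop 0] with n hn
    have hsn := weightScale_pos hτ hw₀ hn
    have ht0 : 0 ≤ t n := by positivity
    have hn1 : (1 : ℝ) ≤ n := by exact_mod_cast hn
    have hb : (1 : ℝ) ≤ (n : ℝ) ^ ((3 - τ) / 2) := Real.one_le_rpow hn1 (by linarith)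
    refine ⟨ht0, hνT n hn, ht0, fun x _ => ?_, ?_, ?_⟩
    · refine le_trans ?_ (hνT n hn)
      rw [← setLIntegral_one]
      exact lintegral_mono fun y => edgeConnect_le_one n x y
    · nlinarith
    · rw [hnt n hn]
      nlinarith
  · have h2 : Tendsto (fun n : ℕ => κ * (κ + 1) ^ (2 * k - 2) * ((n : ℝ) ^ ((3 - τ) / 2))⁻¹)
        atTop (𝓝 0) := by
      have h3 := (((tendsto_rpow_atTop (show 0 < (3 - τ) / 2 by linarith)).comp
        tendsto_natCast_atTop_atTop).inv_tendsto_atTop (𝕜 := ℝ)).const_mul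
          (κ * (κ + 1) ^ (2 * k - 2))
      rw [mul_zero] at h3
      exact h3
    refine h2.congr' ?_
    filter_upwards [eventually_gt_atTop 0] with n hn
    have hn' : (0 : ℝ) < n := by exact_mod_cast hn
    rw [hnt n hn, show (3 - τ) * (k : ℝ) / 2 = (3 - τ) / 2 * k by ring, Real.rpow_mul hn'.le,
      Real.rpow_natCast]
    -- The variance ratio has order `b * b^(2k-2) / b^(2k) = 1 / b`, which vanishes because `τ < 3`.
    set b := (n : ℝ) ^ ((3 - τ) / 2) with hb
    have hb0 : 0 < b := by positivity
    obtain ⟨l, rfl⟩ : ∃ l, k = l + 1 := ⟨k - 1, by omega⟩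
    rw [show 2 * (l + 1) - 2 = 2 * l by omega, mul_pow]
    field_simp
    ring
  · have h2 := (hlim (JNG d k τ γ).toReal).eventually_le_const
      (lt_add_of_pos_right _ hδ)
    filter_upwards [eventually_gt_atTop 0, h2] with n hn h2
    have h3 := choose_mul_cliqueProb_scaled (d := d) (γ := γ) hτ hw₀ hn k MeasurableSet.univ
    simp only [preimage_univ, pi_univ, indicator_univ] at h3
    rw [h3]
    refine mul_le_mul_of_nonneg_right (le_trans ?_ h2) (by positivity)
    have h4 := lintegral_pi_powMeasure_mono (τ := τ) le_rfl
      (div_pos hw₀ (weightScale_pos hτ hw₀ hn)).le (measurable_torusInt (d := d) (γ := γ) (k := k))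
    rw [lintegral_torusInt_powMeasure] at h4
    have h5 := ENNReal.toReal_mono hJ.ne h4
    gcongr
  · have h2 := (hlim (∫⁻ y, torusInt d γ y
      ∂(Measure.pi fun _ : Fin k => powMeasure τ ε)).toReal).eventually_const_le hj
    -- Eventually the rescaled minimal weight `w₀ / s n` is below `ε`, so the truncated integral no
    -- longer depends on `n`.
    have h3 : ∀ᶠ n in atTop, w₀ / ε < s n :=
      (tendsto_weightScale hτ hw₀).eventually_gt_atTop _
    filter_upwards [eventually_gt_atTop 0, h2, h3] with n hn h2 h3
    have hsn := weightScale_pos hτ hw₀ hn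
    rw [choose_mul_cliqueProb_scaled (d := d) (γ := γ) hτ hw₀ hn k measurableSet_Ioi,
      lintegral_pi_powMeasure_indicator (div_pos hw₀ hsn).le _ measurable_torusInt]
    · exact mul_le_mul_of_nonneg_right h2 (by positivity)
    · rw [div_le_iff₀ hsn]
      exact ((div_lt_iff₀' hε0).1 h3).le

theorem tendsto_cliqueProb_spaceInt (hd : 1 ≤ d) (hτ : 2 < τ) (hw₀ : 0 < w₀) (hγ : 1 < γ) {m : ℕ}
    (hm : (3 - τ) * (m + 1) < 2) {B : Set ℝ} (hB : MeasurableSet B) :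
    Tendsto (fun n => ENNReal.ofReal ((weightScale τ w₀ n ^ 2) ^ m) *
        cliqueProb (vertexLaw d τ w₀) (edgeConnect d τ w₀ γ n) (Prod.fst ⁻¹' B) (m + 1)) atTop
      (𝓝 (ENNReal.ofReal ((τ - 1) * w₀ ^ (τ - 1)) ^ (m + 1) *
        ∫⁻ w, (univ.pi fun _ : Fin (m + 1) => B).indicator (spaceInt d γ) w
          ∂(Measure.pi fun _ => powMeasure τ w₀))) := by
  obtain ⟨C, hC0, hC⟩ := exists_lintegral_kernel_le hd hγ
  have hBm : MeasurableSet (univ.pi fun _ : Fin (m + 1) => B) := MeasurableSet.univ_pi fun _ => hB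
  set F : ℕ → (Fin (m + 1) → ℝ) → ℝ≥0∞ := fun n => (univ.pi fun _ : Fin (m + 1) => B).indicator
    fun w => ENNReal.ofReal ((weightScale τ w₀ n ^ 2) ^ m) *
      torusInt d γ (fun i => w i / weightScale τ w₀ n) with hF
  have hmeas : ∀ n, Measurable fun w : Fin (m + 1) → ℝ =>
      torusInt d γ (fun i => w i / weightScale τ w₀ n) := fun n =>
    measurable_torusInt.comp (measurable_pi_lambda _ fun i =>
      (measurable_pi_apply i).div_const _)
  have h1 : ∀ n, ENNReal.ofReal ((weightScale τ w₀ n ^ 2) ^ m) *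
        cliqueProb (vertexLaw d τ w₀) (edgeConnect d τ w₀ γ n) (Prod.fst ⁻¹' B) (m + 1) =
      ENNReal.ofReal ((τ - 1) * w₀ ^ (τ - 1)) ^ (m + 1) *
        ∫⁻ w, F n w ∂(Measure.pi fun _ => powMeasure τ w₀) := by
    intro n
    rw [cliqueProb_vertexLaw hτ hw₀ n (m + 1) hB, mul_left_comm,
      ← lintegral_const_mul _ ((hmeas n).indicator hBm)]
    congr 1
    refine lintegral_congr fun w => ?_
    simp only [hF]
    by_cases hw : w ∈ univ.pi fun _ : Fin (m + 1) => B
    · rw [indicator_of_mem hw, indicator_of_mem hw]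
    · rw [indicator_of_notMem hw, indicator_of_notMem hw, mul_zero]
  simp_rw [h1]
  refine ENNReal.Tendsto.const_mul ?_ (Or.inr (by finiteness))
  refine tendsto_lintegral_filter_of_dominated_convergence
    (minStar fun u v => ENNReal.ofReal (C * (u * v))) ?_ ?_
    (lintegral_minStar_lt_top hτ hw₀ hC0.le hm).ne ?_
  · exact Eventually.of_forall fun n => ((hmeas n).const_mul _).indicator hBm
  · filter_upwards [eventually_gt_atTop 0] with n hn
    filter_upwards [ae_pi_powMeasure (m + 1)] with w hw
    refine (indicator_le_self _ _ _).trans (le_minStar fun c => ?_)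
    exact torusInt_mul_pow_le hC (fun i => (hw₀.trans (hw i)).le) c (weightScale_pos hτ hw₀ hn)
  · filter_upwards [ae_pi_powMeasure (m + 1)] with w hw
    by_cases hwB : w ∈ univ.pi fun _ : Fin (m + 1) => B
    · simp only [hF, indicator_of_mem hwB]
      exact tendsto_torusInt hd hC (fun i => (hw₀.trans (hw i)).le) (tendsto_weightScale hτ hw₀)
    · simp only [hF, indicator_of_notMem hwB]
      exact tendsto_const_nhds

theorem tendsto_lintegral_spaceInt_truncated (hw₀ : 0 < w₀) {k : ℕ} (hJ : JG d k τ w₀ γ < ⊤) :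
    Tendsto (fun j : ℕ => (∫⁻ w, (univ.pi fun _ : Fin k => Ioc 0 ((j : ℝ) + 1)).indicator
      (spaceInt d γ) w ∂(Measure.pi fun _ : Fin k => powMeasure τ w₀)).toReal) atTop
      (𝓝 (JG d k τ w₀ γ).toReal) := by
  refine (ENNReal.tendsto_toReal hJ.ne).comp ?_
  rw [← lintegral_spaceInt_powMeasure hw₀.le] at hJ ⊢
  refine tendsto_lintegral_of_dominated_convergence (spaceInt d γ) (fun j => ?_) (fun j => ?_)
    hJ.ne ?_
  · exact measurable_spaceInt.indicator (MeasurableSet.univ_pi fun _ => measurableSet_Ioc)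
  · exact Eventually.of_forall fun y => indicator_le_self _ _ _
  · filter_upwards [ae_pi_powMeasure k] with y hy
    refine tendsto_const_nhds.congr' ?_
    have h2 : ∀ i, ∀ᶠ j : ℕ in atTop, y i ≤ (j : ℝ) + 1 := fun i =>
      (tendsto_natCast_atTop_atTop.atTop_add tendsto_const_nhds).eventually_ge_atTop _
    filter_upwards [eventually_all.2 h2] with j hj
    exact (indicator_of_mem (show y ∈ univ.pi fun _ : Fin k => Ioc 0 ((j : ℝ) + 1) from
      fun i _ => ⟨hw₀.trans (hy i), hj i⟩) _).symm

/-- Bounded weights connect at probability of order `1 / n`; hence `n ρ` stays bounded in the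
small-clique regime. -/
theorem setLIntegral_edgeConnect_le (hτ : 2 < τ) (hw₀ : 0 < w₀) {C : ℝ} (hC0 : 0 ≤ C)
    (hC : ∀ a : ℝ, 0 ≤ a → ∫⁻ z : Fin d → ℝ, ENNReal.ofReal (kernel d γ a ‖z‖) ≤
      ENNReal.ofReal (C * a)) (n : ℕ) {M : ℝ} (p : ℝ × Torus d)
    (hp : p ∈ (Prod.fst ⁻¹' Ioc 0 M : Set (ℝ × Torus d))) :
    ∫⁻ q in Prod.fst ⁻¹' Ioc 0 M, edgeConnect d τ w₀ γ n p q ∂(vertexLaw d τ w₀) ≤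
      ENNReal.ofReal (C * (M * M / (n * meanWeight τ w₀))) := by
  have := isProbabilityMeasure_weightLaw (show 1 < τ by linarith) hw₀
  have hμ := (meanWeight_pos hτ hw₀).le
  have hp : 0 < p.1 ∧ p.1 ≤ M := hp
  have hB : MeasurableSet (Prod.fst ⁻¹' Ioc 0 M : Set (ℝ × Torus d)) :=
    measurable_fst measurableSet_Ioc
  have hm : Measurable (edgeConnect d τ w₀ γ n p) :=
    show Measurable (Function.uncurry (edgeConnect d τ w₀ γ n) ∘ Prod.mk p) from
      (measurable_edgeConnect n).comp measurable_prodMk_left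
  have hconst : ∫⁻ _, ENNReal.ofReal (C * (M * M / (n * meanWeight τ w₀))) ∂(weightLaw τ w₀) =
      ENNReal.ofReal (C * (M * M / (n * meanWeight τ w₀))) := by
    rw [lintegral_const, measure_univ, mul_one]
  rw [← lintegral_indicator hB, vertexLaw, lintegral_prod _ (hm.indicator hB).aemeasurable,
    ← hconst]
  refine lintegral_mono fun w => ?_
  by_cases hw : w ∈ Ioc 0 M
  · have h1 : ∀ x : Torus d, (Prod.fst ⁻¹' Ioc 0 M : Set (ℝ × Torus d)).indicator
        (edgeConnect d τ w₀ γ n p) (w, x) =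
        ENNReal.ofReal (kernel d γ (p.1 * w / (n * meanWeight τ w₀)) ‖p.2 - x‖) := fun x =>
      indicator_of_mem (show (w, x) ∈ (Prod.fst ⁻¹' Ioc 0 M : Set (ℝ × Torus d)) from hw) _
    simp_rw [h1]
    have hw0 := hw.1.le
    have hp0 := hp.1.le
    refine (lintegral_torus_kernel_le hC (by positivity) p.2).trans (ENNReal.ofReal_le_ofReal ?_)
    have := mul_le_mul hp.2 hw.2 hw.1.le (hp.1.le.trans hp.2)
    gcongr
  · have h1 : ∀ x : Torus d, (Prod.fst ⁻¹' Ioc 0 M : Set (ℝ × Torus d)).indicator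
        (edgeConnect d τ w₀ γ n p) (w, x) = 0 := fun x =>
      indicator_of_notMem (show (w, x) ∉ (Prod.fst ⁻¹' Ioc 0 M : Set (ℝ × Torus d)) from hw) _
    simp_rw [h1]
    simp

/-- For small cliques the count is governed by vertices of bounded weight at distances of order
`n ^ (-1 / d)`. -/
theorem convergesInProbability_of_JG (hd : 1 ≤ d) (hτ : 2 < τ) (hw₀ : 0 < w₀) (hγ : 1 < γ)
    {m : ℕ} (hm : (3 - τ) * (m + 1) < 2)
    (hG : ∀ n, IsGIRG d τ w₀ γ n (P n) (W n) (X n) (G n)) :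
    ConvergesInProbability P
      (fun n ω => (cliqueCount (m + 1) (G n ω) : ℝ) / (n : ℝ))
      (((τ - 1) * w₀ ^ (τ - 1)) ^ (m + 1) * (JG d (m + 1) τ w₀ γ).toReal /
        (meanWeight τ w₀ ^ m * ((m + 1).factorial : ℝ))) := by
  have := isProbabilityMeasure_weightLaw (show 1 < τ by linarith) hw₀
  have := isProbabilityMeasure_vertexLaw (d := d) hτ hw₀
  have hμ := meanWeight_pos hτ hw₀
  have hJ := JG_lt_top hd hτ hw₀ hγ hm
  obtain ⟨C, hC0, hC⟩ := exists_lintegral_kernel_le hd hγ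
  have hτ1 : 0 < τ - 1 := by linarith
  set Λ := (τ - 1) * w₀ ^ (τ - 1) with hΛ
  have hΛ0 : 0 < Λ := by positivity
  set R := meanWeight τ w₀ ^ m * ((m + 1).factorial : ℝ) with hR
  set J : Set ℝ → ℝ≥0∞ := fun B => ∫⁻ w, (univ.pi fun _ : Fin (m + 1) => B).indicator
    (spaceInt d γ) w ∂(Measure.pi fun _ => powMeasure τ w₀) with hJdef
  have hJuniv : J univ = JG d (m + 1) τ w₀ γ := by
    simp only [hJdef, pi_univ, indicator_univ]
    exact lintegral_spaceInt_powMeasure hw₀.le _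
  have hJtop : ∀ B, J B ≠ ⊤ := fun B => by
    refine ne_top_of_le_ne_top hJ.ne (le_trans ?_ (lintegral_spaceInt_powMeasure hw₀.le _).le)
    exact lintegral_mono (indicator_le_self _ _)
  have hlim : ∀ B, MeasurableSet B → Tendsto (fun n : ℕ => (n.choose (m + 1) : ℝ) *
      (cliqueProb (vertexLaw d τ w₀) (edgeConnect d τ w₀ γ n) (Prod.fst ⁻¹' B) (m + 1)).toReal / n)
      atTop (𝓝 (Λ ^ (m + 1) * (J B).toReal / R)) := by
    intro B hB
    have h1 := tendsto_cliqueProb_spaceInt hd hτ hw₀ hγ hm hB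
    have h2 := (ENNReal.tendsto_toReal (ENNReal.mul_ne_top (by finiteness) (hJtop B))).comp h1
    have h3 := ((tendsto_choose_div_pow (m + 1)).mul h2).div_const (meanWeight τ w₀ ^ m)
    rw [ENNReal.toReal_mul, ENNReal.toReal_pow, ENNReal.toReal_ofReal hΛ0.le,
      one_div_mul_eq_div, div_div, mul_comm ((m + 1).factorial : ℝ)] at h3
    refine h3.congr' ?_
    filter_upwards [eventually_gt_atTop 0] with n hn
    have hn' : (0 : ℝ) < n := by exact_mod_cast hn
    simp only [Function.comp_apply, ENNReal.toReal_mul]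
    rw [ENNReal.toReal_ofReal (by positivity), sq_weightScale hτ hw₀, mul_pow]
    field_simp
    ring
  refine convergesInProbability_cliqueCount P _ G (fun n => (hG n).isKernelGraph)
    measurable_edgeConnect edgeConnect_comm edgeConnect_le_one (m + 1) _ ?_ _ fun δ hδ => ?_
  · filter_upwards [eventually_gt_atTop 0] with n hn
    exact_mod_cast hn
  have h1 := ((tendsto_lintegral_spaceInt_truncated hw₀ hJ).const_mul (Λ ^ (m + 1))).div_const R
  obtain ⟨j, hj⟩ := (h1.eventually_const_lt (sub_lt_self _ hδ)).exists
  set M : ℝ := (j : ℝ) + 1 with hM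
  have hM0 : 0 < M := by positivity
  -- With `t = 1` and `β` constant, the variance ratio is a constant times `n / n ^ 2`.
  refine ⟨fun _ => Prod.fst ⁻¹' Ioc 0 M, fun _ => 1,
    fun n => C * (M * M / (n * meanWeight τ w₀)), fun _ => C * (M * M / meanWeight τ w₀) + 1,
    fun n => measurable_fst measurableSet_Ioc, ?_, ?_, ?_, ?_⟩
  · filter_upwards [eventually_gt_atTop 0] with n hn
    have hn' : (0 : ℝ) < n := by exact_mod_cast hn
    refine ⟨zero_le_one, by simpa using prob_le_one, by positivity,
      setLIntegral_edgeConnect_le hτ hw₀ hC0.le hC n, ?_, ?_⟩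
    · have : 0 ≤ C * (M * M / meanWeight τ w₀) := by positivity
      linarith
    · have : n * (C * (M * M / (n * meanWeight τ w₀))) = C * (M * M / meanWeight τ w₀) := by
        field_simp
      linarith
  · have h2 := (tendsto_inv_atTop_zero.comp (tendsto_natCast_atTop_atTop (R := ℝ))).const_mul
      ((C * (M * M / meanWeight τ w₀) + 1) ^ (2 * (m + 1) - 2))
    rw [mul_zero] at h2
    refine h2.congr' ?_
    filter_upwards [eventually_gt_atTop 0] with n hn
    have hn' : (n : ℝ) ≠ 0 := by exact_mod_cast hn.ne'
    simp only [Function.comp_apply]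
    field_simp
  · have h2 := hlim univ MeasurableSet.univ
    rw [hJuniv] at h2
    filter_upwards [eventually_gt_atTop 0, h2.eventually_le_const (lt_add_of_pos_right _ hδ)]
      with n hn h3
    have hn' : (0 : ℝ) < n := by exact_mod_cast hn
    rwa [preimage_univ, div_le_iff₀ hn'] at h3
  · have h2 := hlim (Ioc 0 M) measurableSet_Ioc
    filter_upwards [eventually_gt_atTop 0, h2.eventually_const_le hj] with n hn h3
    have hn' : (0 : ℝ) < n := by exact_mod_cast hn
    rwa [le_div_iff₀ hn'] at h3

end LawsOfLargeNumbers

end GIRG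

end

/-! ### The two regimes. -/

theorem theorem2
    (d : ℕ) (hd : 1 ≤ d) (τ w₀ γ : ℝ) (hτ : 2 < τ) (hτ' : τ < 3) (hw₀ : 0 < w₀) (hγ : 1 < γ)
    (k : ℕ) (hk : 1 ≤ k)
    {Ω : ℕ → Type*} [∀ n, MeasurableSpace (Ω n)]
    (P : ∀ n, Measure (Ω n)) [∀ n, IsProbabilityMeasure (P n)]
    (W : ∀ n, Ω n → Fin n → ℝ) (X : ∀ n, Ω n → Fin n → GIRG.Torus d)
    (G : ∀ n, Ω n → SimpleGraph (Fin n))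
    (hG : ∀ n, GIRG.IsGIRG d τ w₀ γ n (P n) (W n) (X n) (G n)) :
    (2 / (3 - τ) < (k : ℝ) →
      GIRG.JNG d k τ γ < ⊤ ∧
      GIRG.ConvergesInProbability P
        (fun n ω => (GIRG.cliqueCount k (G n ω) : ℝ) / (n : ℝ) ^ ((3 - τ) * (k : ℝ) / 2))
        (((τ - 1) * w₀ ^ (τ - 1)) ^ k * (GIRG.JNG d k τ γ).toReal /
          (GIRG.meanWeight τ w₀ ^ ((τ - 1) * (k : ℝ) / 2) * (k.factorial : ℝ)))) ∧
    ((k : ℝ) < 2 / (3 - τ) →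
      GIRG.JG d k τ w₀ γ < ⊤ ∧
      GIRG.ConvergesInProbability P
        (fun n ω => (GIRG.cliqueCount k (G n ω) : ℝ) / (n : ℝ))
        (((τ - 1) * w₀ ^ (τ - 1)) ^ k * (GIRG.JG d k τ w₀ γ).toReal /
          (GIRG.meanWeight τ w₀ ^ (k - 1) * (k.factorial : ℝ)))) := by
  -- The `m = k - 1` vertices other than the root are the leaves of the stars; `hk` makes the
  -- truncated subtraction harmless.
  obtain ⟨m, rfl⟩ : ∃ m, k = m + 1 := ⟨k - 1, by omega⟩
  have h3 : 0 < 3 - τ := by linarith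
  constructor
  · intro h
    have hm : 2 < (3 - τ) * ((m : ℝ) + 1) := by
      rw [div_lt_iff₀' h3] at h
      exact_mod_cast h
    have hJ := GIRG.JNG_lt_top hd hτ hγ hm
    exact ⟨hJ, GIRG.convergesInProbability_of_JNG P W X G hτ hτ' hw₀ hk hJ hG⟩
  · intro h
    have hm : (3 - τ) * ((m : ℝ) + 1) < 2 := by
      rw [lt_div_iff₀' h3] at h
      exact_mod_cast h
    exact ⟨GIRG.JG_lt_top hd hτ hw₀ hγ hm,
      GIRG.convergesInProbability_of_JG P W X G hd hτ hw₀ hγ hm hG⟩
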